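/- All algebras are associative algebras over $\mathbb C$, not necessarily unital, with non-degenerate product; $M(A)$ is the multiplier algebra of $A$, and $\iota$ is the identity map. A *regular multiplier Hopf algebra* is such an algebra $A$ with a coassociative homomorphism $\Delta:A\to M(A\otimes A)$ such that $a\otimes b\mapsto\Delta(a)(1\otimes b)$, $(a\otimes 1)\Delta(b)$, $\Delta(a)(b\otimes 1)$, $(1\otimes a)\Delta(b)$ all define bijections of $A\otimes A$ onto itself. A *left (right) integral* is a non-zero functional $\varphi$ (resp. $\psi$) with $(\iota\otimes\varphi)\Delta(a)=\varphi(a)1$ (resp. $(\psi\otimes\iota)\Delta(a)=\psi(a)1$) in $M(A)$ for all $a$. A *pairing* of regular multiplier Hopf algebras $A,B$ is a non-degenerate bilinear form $\langle\cdot,\cdot\rangle$ on $A\times B$ such that: 1. there are a left and a right action of $A$ on $B$ and of $B$ on $A$ with $$\langle a',a\triangleright b\rangle=\langle a'a,b\rangle,\quad \langle a',b\triangleleft a\rangle=\langle aa',b\rangle,\quad \langle b\triangleright a,b'\rangle=\langle a,b'b\rangle,\quad \langle a\triangleleft b,b'\rangle=\langle a,bb'\rangle,$$ and all four are unital (the elements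 of the form $a\triangleright b$ span $B$, and similarly for the others); 2. products and coproducts are dual: $\langle\Delta(a),b\otimes b'\rangle=\langle a,bb'\rangle$ and $\langle a\otimes a',\Delta(b)\rangle=\langle aa',b\rangle$, which means $\langle\Delta(a)(1\otimes a'),b\otimes b'\rangle=\langle a,b(a'\triangleright b')\rangle$ and $\langle a\otimes a',(b\otimes 1)\Delta(b')\rangle=\langle (a\triangleleft b)a',b'\rangle$; 3. $R(a\otimes b)=\sum\langle a_{(2)},b_{(1)}\rangle\,a_{(1)}\otimes b_{(2)}$ is a well-defined bijection of $A\otimes B$ onto itself. **Proposition.** Let $A$ be a regular multiplier Hopf algebra with a left integral $\varphi$. Let $B=\widehat A=\{\varphi(\cdot\,c)\mid c\in A\}$, with the product for which $bb'$ is the functional $a\mapsto(\varphi\otimes\varphi)(\Delta(a)(c\otimes c'))$ when $b=\varphi(\cdot\,c)$ and $b'=\varphi(\cdot\,c')$. Then every $b\in B$ equals $\varphi(\cdot\,c)$ for a unique $c\in A$, so that $\langle a,\varphi(\cdot\,c)\rangle=\varphi(ac)$ is a well-defined bilinear form on $A\times B$. The algebra $A$ has a counit $\varepsilon$, a bijective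 antipode $S:A\to A$ and an automorphism $\sigma$ with $\varphi(ab)=\varphi(b\sigma(a))$ for all $a,b$, and $\varphi\circ S$ is a right integral. There is exactly one regular multiplier Hopf algebra structure on the algebra $B$ for which this form is a pairing of regular multiplier Hopf algebras and the following formulas hold: * $a\triangleright\varphi(\cdot\,c)=\varphi(\cdot\,ac)$ and $\varphi(\cdot\,c)\triangleleft a=\varphi(\cdot\,c\,\sigma(a))$; * $B=\{\varphi(c\,\cdot)\mid c\in A\}$, and if $b=\varphi(c\,\cdot)$ then $b\triangleright a=S\big((\iota\otimes\varphi)(\Delta(c)(1\otimes a))\big)$; * for every right integral $\psi$ (in particular $\psi=\varphi\circ S$), $B=\{\psi(\cdot\,c)\mid c\in A\}$, and if $b=\psi(\cdot\,c)$ then $a\triangleleft b=S\big((\psi\otimes\iota)((a\otimes 1)\Delta(c))\big)$. -/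

import Mathlib

open TensorProduct

namespace MultiplierHopf

section Multipliers

/-- The multiplier algebra `M(A)` of a complex algebra `A` (not assumed unital): pairs consisting of
a left multiplication `b ↦ m b` and a right multiplication `a ↦ a m` with `(a m) b = a (m b)`.
The last two conditions are automatic if the product of `A` is non-degenerate. -/
def MultiplierAlgebra (A : Type*) [NonUnitalRing A] [Module ℂ A] [SMulCommClass ℂ A A]
    [IsScalarTower ℂ A A] : Subalgebra ℂ (Module.End ℂ A × (Module.End ℂ A)ᵐᵒᵖ) where
  carrier := {m | (∀ a b : A, m.2.unop a * b = a * m.1 b) ∧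
    (∀ a b : A, m.1 (a * b) = m.1 a * b) ∧ (∀ a b : A, m.2.unop (a * b) = a * m.2.unop b)}
  mul_mem' := by
    rintro m n ⟨hm, hm₁, hm₂⟩ ⟨hn, hn₁, hn₂⟩
    refine ⟨fun a b => ?_, fun a b => ?_, fun a b => ?_⟩
    · simp [hm, hn]
    · simp [hm₁, hn₁]
    · simp [hm₂, hn₂]
  add_mem' := by
    rintro m n ⟨hm, hm₁, hm₂⟩ ⟨hn, hn₁, hn₂⟩
    refine ⟨fun a b => ?_, fun a b => ?_, fun a b => ?_⟩
    · simp [hm, hn, add_mul, mul_add]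
    · simp [hm₁, hn₁, add_mul]
    · simp [hm₂, hn₂, mul_add]
  algebraMap_mem' := by
    intro r
    refine ⟨fun a b => ?_, fun a b => ?_, fun a b => ?_⟩ <;>
      simp [Algebra.algebraMap_eq_smul_one, smul_mul_assoc, mul_smul_comm]

variable {A : Type*} [NonUnitalRing A] [Module ℂ A] [SMulCommClass ℂ A A] [IsScalarTower ℂ A A]
variable {B : Type*} [NonUnitalRing B] [Module ℂ B] [SMulCommClass ℂ B B] [IsScalarTower ℂ B B]

/-- The map `b ↦ m b`. -/
def mulL (m : MultiplierAlgebra A) : A →ₗ[ℂ] A := m.1.1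

/-- The map `a ↦ a m`. -/
def mulR (m : MultiplierAlgebra A) : A →ₗ[ℂ] A := m.1.2.unop

/-- `m ↦ (b ↦ m b)` as a linear map. -/
def mulLHom : MultiplierAlgebra A →ₗ[ℂ] A →ₗ[ℂ] A where
  toFun m := mulL m
  map_add' _ _ := rfl
  map_smul' _ _ := rfl

theorem mulR_mul_eq (m : MultiplierAlgebra A) (a b : A) :
    mulR m a * b = a * mulL m b := m.2.1 a b

theorem mulL_map_mul (m : MultiplierAlgebra A) (a b : A) :
    mulL m (a * b) = mulL m a * b := m.2.2.1 a b

theorem mulR_map_mul (m : MultiplierAlgebra A) (a b : A) :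
    mulR m (a * b) = a * mulR m b := m.2.2.2 a b

@[simp] theorem mulL_mul_apply (m n : MultiplierAlgebra A) (a : A) :
    mulL (m * n) a = mulL m (mulL n a) := rfl

@[simp] theorem mulR_mul_apply (m n : MultiplierAlgebra A) (a : A) :
    mulR (m * n) a = mulR n (mulR m a) := rfl

/-- The canonical map `A → M(A)`; injective if the product of `A` is non-degenerate. -/
def toMultiplier (A : Type*) [NonUnitalRing A] [Module ℂ A] [SMulCommClass ℂ A A]
    [IsScalarTower ℂ A A] : A →ₙₐ[ℂ] MultiplierAlgebra A where
  toFun a := ⟨(LinearMap.mulLeft ℂ a, MulOpposite.op (LinearMap.mulRight ℂ a)), by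
    refine ⟨fun x y => ?_, fun x y => ?_, fun x y => ?_⟩ <;> simp [mul_assoc]⟩
  map_smul' r a := by
    apply Subtype.ext
    refine Prod.ext ?_ (MulOpposite.unop_injective ?_) <;> ext x <;>
      simp [smul_mul_assoc, mul_smul_comm]
  map_zero' := by
    apply Subtype.ext
    refine Prod.ext ?_ (MulOpposite.unop_injective ?_) <;> ext x <;> simp
  map_add' a b := by
    apply Subtype.ext
    refine Prod.ext ?_ (MulOpposite.unop_injective ?_) <;> ext x <;> simp [add_mul, mul_add]
  map_mul' a b := by
    apply Subtype.ext
    refine Prod.ext ?_ (MulOpposite.unop_injective ?_) <;> ext x <;> simp [mul_assoc]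

@[simp] theorem toMultiplier_mulL (a x : A) : mulL (toMultiplier A a) x = a * x := rfl

@[simp] theorem toMultiplier_mulR (a x : A) : mulR (toMultiplier A a) x = x * a := rfl

/-- The multiplier `m ⊗ n` of `A ⊗ B`, for `m ∈ M(A)` and `n ∈ M(B)`. -/
def tensorMultiplier (m : MultiplierAlgebra A) (n : MultiplierAlgebra B) :
    MultiplierAlgebra (A ⊗[ℂ] B) :=
  ⟨(TensorProduct.map (mulL m) (mulL n), MulOpposite.op (TensorProduct.map (mulR m) (mulR n))), by
    refine ⟨fun x y => ?_, fun x y => ?_, fun x y => ?_⟩ <;>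
    · induction x with
      | zero => simp
      | add x₁ x₂ h₁ h₂ => simp only [add_mul, map_add, h₁, h₂]
      | tmul a b =>
        induction y with
        | zero => simp
        | add y₁ y₂ h₁ h₂ => simp only [mul_add, map_add, h₁, h₂]
        | tmul c d =>
          simp [mulR_mul_eq, mulL_map_mul,
            mulR_map_mul]⟩

/-- The multiplier `1 ⊗ a` of `A ⊗ A`. -/
def oneTmul (a : A) : MultiplierAlgebra (A ⊗[ℂ] A) := tensorMultiplier 1 (toMultiplier A a)

/-- The multiplier `a ⊗ 1` of `A ⊗ A`. -/
def tmulOne (a : A) : MultiplierAlgebra (A ⊗[ℂ] A) := tensorMultiplier (toMultiplier A a) 1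

@[simp] theorem mulL_oneTmul (a x y : A) : mulL (oneTmul a) (x ⊗ₜ y) = x ⊗ₜ (a * y) := rfl

@[simp] theorem mulR_oneTmul (a x y : A) : mulR (oneTmul a) (x ⊗ₜ y) = x ⊗ₜ (y * a) := rfl

@[simp] theorem mulL_tmulOne (a x y : A) : mulL (tmulOne a) (x ⊗ₜ y) = (a * x) ⊗ₜ y := rfl

@[simp] theorem mulR_tmulOne (a x y : A) : mulR (tmulOne a) (x ⊗ₜ y) = (x * a) ⊗ₜ y := rfl

end Multipliers

section Slices

variable {V W : Type*} [AddCommGroup V] [Module ℂ V] [AddCommGroup W] [Module ℂ W]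

/-- The slice map `ι ⊗ f`. -/
noncomputable def sliceRight (V : Type*) [AddCommGroup V] [Module ℂ V] (f : W →ₗ[ℂ] ℂ) :
    V ⊗[ℂ] W →ₗ[ℂ] V :=
  (TensorProduct.rid ℂ V).toLinearMap ∘ₗ f.lTensor V

/-- The slice map `f ⊗ ι`. -/
noncomputable def sliceLeft (f : V →ₗ[ℂ] ℂ) (W : Type*) [AddCommGroup W] [Module ℂ W] :
    V ⊗[ℂ] W →ₗ[ℂ] W :=
  (TensorProduct.lid ℂ W).toLinearMap ∘ₗ f.rTensor W

@[simp] theorem sliceRight_tmul (f : W →ₗ[ℂ] ℂ) (v : V) (w : W) :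
    sliceRight V f (v ⊗ₜ w) = f w • v := by simp [sliceRight]

@[simp] theorem sliceLeft_tmul (f : V →ₗ[ℂ] ℂ) (v : V) (w : W) :
    sliceLeft f W (v ⊗ₜ w) = f v • w := by simp [sliceLeft]

end Slices

/-- A regular multiplier Hopf algebra structure on a complex algebra `A` with non-degenerate
product: a homomorphism `Δ : A → M(A ⊗ A)` such that all the elements
`Δ(a)(1 ⊗ b)`, `(a ⊗ 1)Δ(b)`, `Δ(a)(b ⊗ 1)` and `(1 ⊗ a)Δ(b)` lie in `A ⊗ A`, the four canonical
maps `T₁, T₂, T₃, T₄ : A ⊗ A → A ⊗ A` they define are bijective, and `Δ` is coassociative.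
(The canonical maps are determined by `Δ`.) -/
structure RegularMultiplierHopfAlgebra (A : Type*) [NonUnitalRing A] [Module ℂ A]
    [SMulCommClass ℂ A A] [IsScalarTower ℂ A A] where
  nondegenerate_left : ∀ a : A, (∀ b : A, a * b = 0) → a = 0
  nondegenerate_right : ∀ a : A, (∀ b : A, b * a = 0) → a = 0
  comul : A →ₙₐ[ℂ] MultiplierAlgebra (A ⊗[ℂ] A)
  T₁ : A ⊗[ℂ] A ≃ₗ[ℂ] A ⊗[ℂ] A
  T₂ : A ⊗[ℂ] A ≃ₗ[ℂ] A ⊗[ℂ] A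
  T₃ : A ⊗[ℂ] A ≃ₗ[ℂ] A ⊗[ℂ] A
  T₄ : A ⊗[ℂ] A ≃ₗ[ℂ] A ⊗[ℂ] A
  T₁_spec : ∀ a b : A, toMultiplier (A ⊗[ℂ] A) (T₁ (a ⊗ₜ b)) = comul a * oneTmul b
  T₂_spec : ∀ a b : A, toMultiplier (A ⊗[ℂ] A) (T₂ (a ⊗ₜ b)) = tmulOne a * comul b
  T₃_spec : ∀ a b : A, toMultiplier (A ⊗[ℂ] A) (T₃ (a ⊗ₜ b)) = comul a * tmulOne b
  T₄_spec : ∀ a b : A, toMultiplier (A ⊗[ℂ] A) (T₄ (a ⊗ₜ b)) = oneTmul a * comul b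
  /-- `(a ⊗ 1 ⊗ 1)(Δ ⊗ ι)(Δ(b)(1 ⊗ c)) = (ι ⊗ Δ)((a ⊗ 1)Δ(b))(1 ⊗ 1 ⊗ c)` -/
  coassoc : ∀ a b c : A,
    T₂.toLinearMap.rTensor A ((TensorProduct.assoc ℂ A A A).symm (a ⊗ₜ T₁ (b ⊗ₜ c))) =
      (TensorProduct.assoc ℂ A A A).symm
        (T₁.toLinearMap.lTensor A (TensorProduct.assoc ℂ A A A (T₂ (a ⊗ₜ b) ⊗ₜ c)))

variable {A : Type*} [NonUnitalRing A] [Module ℂ A] [SMulCommClass ℂ A A] [IsScalarTower ℂ A A]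
variable {B : Type*} [NonUnitalRing B] [Module ℂ B] [SMulCommClass ℂ B B] [IsScalarTower ℂ B B]

/-- `ε` is the counit: a homomorphism with `(ε ⊗ ι)(Δ(a)(1 ⊗ b)) = ab` and
`(ι ⊗ ε)((a ⊗ 1)Δ(b)) = ab`. -/
structure RegularMultiplierHopfAlgebra.IsCounit (H : RegularMultiplierHopfAlgebra A)
    (ε : A →ₙₐ[ℂ] ℂ) : Prop where
  left : ∀ a b : A, sliceLeft (ε : A →ₗ[ℂ] ℂ) A (H.T₁ (a ⊗ₜ b)) = a * b
  right : ∀ a b : A, sliceRight A (ε : A →ₗ[ℂ] ℂ) (H.T₂ (a ⊗ₜ b)) = a * b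

/-- `S` is the antipode (`ε` being the counit): `m(S ⊗ ι)(Δ(a)(1 ⊗ b)) = ε(a)b` and
`m(ι ⊗ S)((a ⊗ 1)Δ(b)) = ε(b)a`, where `m` is the multiplication `A ⊗ A → A`. -/
structure RegularMultiplierHopfAlgebra.IsAntipode (H : RegularMultiplierHopfAlgebra A)
    (ε : A →ₙₐ[ℂ] ℂ) (S : A →ₗ[ℂ] A) : Prop where
  left : ∀ a b : A, LinearMap.mul' ℂ A (S.rTensor A (H.T₁ (a ⊗ₜ b))) = ε a • b
  right : ∀ a b : A, LinearMap.mul' ℂ A (S.lTensor A (H.T₂ (a ⊗ₜ b))) = ε b • a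

/-- A left integral: a non-zero linear functional `φ` with `(ι ⊗ φ)Δ(a) = φ(a)1` in `M(A)`, where
the multiplier `(ι ⊗ φ)Δ(a)` is given by `b ↦ (ι ⊗ φ)(Δ(a)(b ⊗ 1))` and
`b ↦ (ι ⊗ φ)((b ⊗ 1)Δ(a))`. -/
structure LeftIntegral (H : RegularMultiplierHopfAlgebra A) where
  toFun : A →ₗ[ℂ] ℂ
  ne_zero : toFun ≠ 0
  invariant_left : ∀ a b : A, sliceRight A toFun (H.T₃ (a ⊗ₜ b)) = toFun a • b
  invariant_right : ∀ a b : A, sliceRight A toFun (H.T₂ (b ⊗ₜ a)) = toFun a • b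

/-- A right integral: a non-zero linear functional `ψ` with `(ψ ⊗ ι)Δ(a) = ψ(a)1` in `M(A)`. -/
structure RightIntegral (H : RegularMultiplierHopfAlgebra A) where
  toFun : A →ₗ[ℂ] ℂ
  ne_zero : toFun ≠ 0
  invariant_left : ∀ a b : A, sliceLeft toFun A (H.T₁ (a ⊗ₜ b)) = toFun a • b
  invariant_right : ∀ a b : A, sliceLeft toFun A (H.T₄ (b ⊗ₜ a)) = toFun a • b

section Lemmas

theorem eq_zero_of_sliceLeft {V W : Type*} [AddCommGroup V] [Module ℂ V] [AddCommGroup W]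
    [Module ℂ W] (x : V ⊗[ℂ] W) (h : ∀ f : V →ₗ[ℂ] ℂ, sliceLeft f W x = 0) : x = 0 := by
  classical
  let b := Module.Basis.ofVectorSpace ℂ V
  apply (TensorProduct.equivFinsuppOfBasisLeft b (N := W)).injective
  rw [map_zero]
  ext i
  rw [Finsupp.zero_apply, ← h (b.coord i)]
  clear h
  induction x with
  | zero => simp
  | add x y hx hy => simp only [map_add, Finsupp.add_apply, hx, hy]
  | tmul v w => simp

theorem eq_zero_of_sliceRight {V W : Type*} [AddCommGroup V] [Module ℂ V] [AddCommGroup W]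
    [Module ℂ W] (x : V ⊗[ℂ] W) (h : ∀ f : W →ₗ[ℂ] ℂ, sliceRight V f x = 0) : x = 0 := by
  apply (TensorProduct.comm ℂ V W).injective
  rw [map_zero]
  refine eq_zero_of_sliceLeft _ fun f => ?_
  rw [← h f]
  have : sliceLeft f V ∘ₗ (TensorProduct.comm ℂ V W).toLinearMap = sliceRight V f := by
    ext v w
    simp
  exact LinearMap.congr_fun this x

namespace RegularMultiplierHopfAlgebra

theorem cancel_left (H : RegularMultiplierHopfAlgebra A) {x y : A}
    (h : ∀ p : A, p * x = p * y) : x = y := by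
  rw [← sub_eq_zero]
  exact H.nondegenerate_right _ fun p => by rw [mul_sub, h, sub_self]

theorem tensor_nondegenerate (H : RegularMultiplierHopfAlgebra A) (x : A ⊗[ℂ] A)
    (h : ∀ y : A ⊗[ℂ] A, x * y = 0) : x = 0 := by
  refine eq_zero_of_sliceLeft x fun g => H.nondegenerate_left _ fun b => ?_
  have hb : mulR (oneTmul b) x = 0 := by
    refine eq_zero_of_sliceRight _ fun f => H.nondegenerate_left _ fun a => ?_
    have key : ∀ z : A ⊗[ℂ] A,
        sliceRight A f (mulR (oneTmul b) z) * a = sliceRight A f (z * (a ⊗ₜ b)) := by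
      intro z
      induction z with
      | zero => simp
      | add z w hz hw => simp only [map_add, add_mul, hz, hw]
      | tmul u v => simp [smul_mul_assoc]
    rw [key, h, map_zero]
  have key : ∀ z : A ⊗[ℂ] A, sliceLeft g A z * b = sliceLeft g A (mulR (oneTmul b) z) := by
    intro z
    induction z with
    | zero => simp
    | add z w hz hw => simp only [map_add, add_mul, hz, hw]
    | tmul u v => simp [smul_mul_assoc]
  rw [key, hb, map_zero]

theorem toMultiplier_injective (H : RegularMultiplierHopfAlgebra A) :
    Function.Injective (toMultiplier (A ⊗[ℂ] A)) := by
  intro x y hxy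
  rw [← sub_eq_zero]
  refine H.tensor_nondegenerate _ fun z => ?_
  rw [sub_mul, sub_eq_zero]
  exact congrArg (fun m => mulL m z) hxy

/-- `(p ⊗ 1)(Δ(a)(1 ⊗ c)) = ((p ⊗ 1)Δ(a))(1 ⊗ c)` -/
theorem T₁_T₂ (H : RegularMultiplierHopfAlgebra A) (p a c : A) :
    mulL (tmulOne p) (H.T₁ (a ⊗ₜ c)) = mulR (oneTmul c) (H.T₂ (p ⊗ₜ a)) := by
  rw [← sub_eq_zero]
  refine H.tensor_nondegenerate _ fun z => ?_
  rw [sub_mul, sub_eq_zero, mulR_mul_eq, ← mulL_map_mul]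
  have h₁ := congrArg (fun m => mulL m z) (H.T₁_spec a c)
  have h₂ := congrArg (fun m => mulL m (mulL (oneTmul c) z)) (H.T₂_spec p a)
  simp only [toMultiplier_mulL, mulL_mul_apply] at h₁ h₂
  rw [h₁, h₂]

/-- `Δ(a)(Δ(p)(q ⊗ 1)) = Δ(ap)(q ⊗ 1)` -/
theorem comul_mulL_T₃ (H : RegularMultiplierHopfAlgebra A) (a p q : A) :
    mulL (H.comul a) (H.T₃ (p ⊗ₜ q)) = H.T₃ ((a * p) ⊗ₜ q) := by
  rw [← sub_eq_zero]
  refine H.tensor_nondegenerate _ fun z => ?_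
  rw [sub_mul, sub_eq_zero, ← mulL_map_mul]
  have h₁ := congrArg (fun m => mulL m z) (H.T₃_spec p q)
  have h₂ := congrArg (fun m => mulL m z) (H.T₃_spec (a * p) q)
  simp only [toMultiplier_mulL, mulL_mul_apply, map_mul] at h₁ h₂
  rw [h₁, h₂]

/-- `(Δ(a)(1 ⊗ c))(d ⊗ 1) = Δ(a)(d ⊗ c)` -/
theorem T₁_mulR (H : RegularMultiplierHopfAlgebra A) (a c d : A) :
    mulR (tmulOne d) (H.T₁ (a ⊗ₜ c)) = mulL (H.comul a) (d ⊗ₜ c) := by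
  rw [← sub_eq_zero]
  refine H.tensor_nondegenerate _ fun z => ?_
  rw [sub_mul, sub_eq_zero, mulR_mul_eq, ← mulL_map_mul]
  have h₁ := congrArg (fun m => mulL m (mulL (tmulOne d) z)) (H.T₁_spec a c)
  simp only [toMultiplier_mulL, mulL_mul_apply] at h₁
  rw [h₁]
  congr 1
  clear h₁
  induction z with
  | zero => simp
  | add z w hz hw => simp only [map_add, mul_add, hz, hw]
  | tmul u v => simp

end RegularMultiplierHopfAlgebra

end Lemmas

namespace LeftIntegral

variable {H : RegularMultiplierHopfAlgebra A} (φ : LeftIntegral H)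

/-- The map `c ↦ φ(· c)` from `A` to the linear dual of `A`. -/
noncomputable def functional : A →ₗ[ℂ] Module.Dual ℂ A :=
  (LinearMap.mul ℂ A).flip.compr₂ φ.toFun

@[simp] theorem functional_apply (c a : A) : φ.functional c a = φ.toFun (a * c) := rfl

/-- The underlying space of the dual `Â = {φ(· c) | c ∈ A}`. -/
noncomputable def dual : Submodule ℂ (Module.Dual ℂ A) := LinearMap.range φ.functional

/-- The element `φ(· c)` of `Â`. -/
noncomputable def elem (c : A) : φ.dual := ⟨φ.functional c, LinearMap.mem_range_self _ c⟩

@[simp] theorem coe_elem (c a : A) : (φ.elem c).1 a = φ.toFun (a * c) := rfl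

/-- The canonical pairing `⟨a, b⟩ = b(a)`, that is `⟨a, φ(· c)⟩ = φ(ac)`. -/
noncomputable def pairing : A →ₗ[ℂ] φ.dual →ₗ[ℂ] ℂ := φ.dual.subtype.flip

@[simp] theorem pairing_apply (a : A) (b : φ.dual) : φ.pairing a b = b.1 a := rfl

theorem mem_dual {f : Module.Dual ℂ A} : f ∈ φ.dual ↔ ∃ c, φ.functional c = f := Iff.rfl

/-- An element `c` with `b = φ(· c)`. -/
noncomputable def repr (b : φ.dual) : A := Classical.choose b.2

@[simp] theorem functional_repr (b : φ.dual) : φ.functional (φ.repr b) = b.1 :=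
  Classical.choose_spec b.2

/-- For `c, d ∈ A`, the functional `a ↦ (φ ⊗ φ)(Δ(a)(c ⊗ d))`. -/
noncomputable def mulFunctional (c d : A) : Module.Dual ℂ A :=
  φ.toFun ∘ₗ sliceRight A φ.toFun ∘ₗ
    LinearMap.applyₗ (c ⊗ₜ[ℂ] d) ∘ₗ mulLHom ∘ₗ (H.comul : A →ₗ[ℂ] MultiplierAlgebra (A ⊗[ℂ] A))

theorem mulFunctional_apply (c d a : A) :
    φ.mulFunctional c d a = φ.toFun (sliceRight A φ.toFun (mulL (H.comul a) (c ⊗ₜ d))) := rfl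

theorem mul_slice (p a c : A) :
    p * sliceRight A φ.toFun (H.T₁ (a ⊗ₜ c)) =
      sliceRight A (φ.functional c) (H.T₂ (p ⊗ₜ a)) := by
  have k₁ : ∀ z : A ⊗[ℂ] A,
      p * sliceRight A φ.toFun z = sliceRight A φ.toFun (mulL (tmulOne p) z) := by
    intro z
    induction z with
    | zero => simp
    | add z w hz hw => simp only [map_add, mul_add, hz, hw]
    | tmul u v => simp [mul_smul_comm]
  have k₂ : ∀ z : A ⊗[ℂ] A,
      sliceRight A φ.toFun (mulR (oneTmul c) z) = sliceRight A (φ.functional c) z := by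
    intro z
    induction z with
    | zero => simp
    | add z w hz hw => simp only [map_add, hz, hw]
    | tmul u v => simp
  rw [k₁, H.T₁_T₂, k₂]

/-- `(φ ⊗ φ)(Δ(a)(c ⊗ d))` depends on `c` only through `φ(· c)`. -/
theorem mulFunctional_eq (c d a : A) :
    φ.mulFunctional c d a = φ.functional c (sliceRight A φ.toFun (H.T₁ (a ⊗ₜ d))) := by
  have k : ∀ z : A ⊗[ℂ] A,
      sliceRight A φ.toFun (mulR (tmulOne c) z) = sliceRight A φ.toFun z * c := by
    intro z
    induction z with
    | zero => simp
    | add z w hz hw => simp only [map_add, add_mul, hz, hw]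
    | tmul u v => simp [smul_mul_assoc]
  rw [mulFunctional_apply, ← H.T₁_mulR, k, functional_apply]

theorem mulFunctional_congr {c c' d d' : A} (hc : φ.functional c = φ.functional c')
    (hd : φ.functional d = φ.functional d') : φ.mulFunctional c d = φ.mulFunctional c' d' := by
  ext a
  rw [mulFunctional_eq, mulFunctional_eq, hc]
  congr 1
  exact H.cancel_left fun p => by rw [mul_slice, mul_slice, hd]

theorem mulFunctional_mem (c d : A) : φ.mulFunctional c d ∈ φ.dual := by
  obtain ⟨x, hx⟩ := H.T₃.surjective (c ⊗ₜ d)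
  refine ⟨sliceRight A φ.toFun x, ?_⟩
  ext a
  rw [mulFunctional_apply, ← hx, functional_apply]
  clear hx
  induction x with
  | zero => simp
  | add z w hz hw => simp only [map_add, mul_add, hz, hw]
  | tmul p q =>
    rw [H.comul_mulL_T₃, φ.invariant_left]
    simp [mul_smul_comm, mul_comm]

/-- The product of `Â`: `(bb')(a) = (φ ⊗ φ)(Δ(a)(c ⊗ d))` for `b = φ(· c)` and `b' = φ(· d)`, that
is `⟨a, bb'⟩ = ⟨Δ(a), b ⊗ b'⟩`. -/
noncomputable instance : Mul φ.dual :=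
  ⟨fun b b' => ⟨φ.mulFunctional (φ.repr b) (φ.repr b'), φ.mulFunctional_mem _ _⟩⟩

theorem coe_mul (b b' : φ.dual) :
    ((b * b' : φ.dual) : Module.Dual ℂ A) = φ.mulFunctional (φ.repr b) (φ.repr b') := rfl

theorem elem_mul_elem_apply (c d a : A) :
    (φ.elem c * φ.elem d).1 a =
      φ.toFun (sliceRight A φ.toFun (mulL (H.comul a) (c ⊗ₜ d))) := by
  rw [coe_mul, ← mulFunctional_apply]
  exact LinearMap.congr_fun (φ.mulFunctional_congr (by simp [elem]) (by simp [elem])) a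

theorem mulFunctional_add_left (c c' d : A) :
    φ.mulFunctional (c + c') d = φ.mulFunctional c d + φ.mulFunctional c' d := by
  ext a
  simp [mulFunctional_apply, TensorProduct.add_tmul]

theorem mulFunctional_add_right (c d d' : A) :
    φ.mulFunctional c (d + d') = φ.mulFunctional c d + φ.mulFunctional c d' := by
  ext a
  simp [mulFunctional_apply, TensorProduct.tmul_add]

theorem mulFunctional_smul_left (r : ℂ) (c d : A) :
    φ.mulFunctional (r • c) d = r • φ.mulFunctional c d := by
  ext a
  simp only [mulFunctional_apply, LinearMap.smul_apply, ← TensorProduct.smul_tmul', map_smul]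

theorem mulFunctional_smul_right (r : ℂ) (c d : A) :
    φ.mulFunctional c (r • d) = r • φ.mulFunctional c d := by
  ext a
  simp [mulFunctional_apply]

theorem dual_add_mul (b b' b'' : φ.dual) : (b + b') * b'' = b * b'' + b' * b'' := by
  apply Subtype.ext
  rw [Submodule.coe_add, coe_mul, coe_mul, coe_mul, ← mulFunctional_add_left]
  exact φ.mulFunctional_congr (by simp) rfl

theorem dual_mul_add (b b' b'' : φ.dual) : b * (b' + b'') = b * b' + b * b'' := by
  apply Subtype.ext
  rw [Submodule.coe_add, coe_mul, coe_mul, coe_mul, ← mulFunctional_add_right]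
  exact φ.mulFunctional_congr rfl (by simp)

theorem dual_smul_mul (r : ℂ) (b b' : φ.dual) : (r • b) * b' = r • (b * b') := by
  apply Subtype.ext
  rw [Submodule.coe_smul, coe_mul, coe_mul, ← mulFunctional_smul_left]
  exact φ.mulFunctional_congr (by simp) rfl

theorem dual_mul_smul (r : ℂ) (b b' : φ.dual) : b * (r • b') = r • (b * b') := by
  apply Subtype.ext
  rw [Submodule.coe_smul, coe_mul, coe_mul, ← mulFunctional_smul_right]
  exact φ.mulFunctional_congr rfl (by simp)

theorem dual_mul_apply (b b' : φ.dual) (a : A) :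
    (b * b').1 a = b.1 (sliceRight A φ.toFun (H.T₁ (a ⊗ₜ φ.repr b'))) := by
  rw [coe_mul, mulFunctional_eq, functional_repr]

theorem dual_mul_assoc (b b' b'' : φ.dual) : b * b' * b'' = b * (b' * b'') := by
  apply Subtype.ext
  ext a
  rw [dual_mul_apply, dual_mul_apply, dual_mul_apply]
  congr 1
  refine H.cancel_left fun p => ?_
  rw [mul_slice, mul_slice, functional_repr, functional_repr]
  have k₁ : ∀ z : A ⊗[ℂ] A, H.T₂ (p ⊗ₜ sliceRight A φ.toFun z) =
      sliceRight (A ⊗[ℂ] A) φ.toFun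
        (H.T₂.toLinearMap.rTensor A ((TensorProduct.assoc ℂ A A A).symm (p ⊗ₜ z))) := by
    intro z
    induction z with
    | zero => simp
    | add z w hz hw => simp only [map_add, TensorProduct.tmul_add, hz, hw]
    | tmul u v => simp
  have k₂ : ∀ (u : A) (z : A ⊗[ℂ] A),
      sliceRight (A ⊗[ℂ] A) φ.toFun ((TensorProduct.assoc ℂ A A A).symm (u ⊗ₜ z)) =
        u ⊗ₜ sliceRight A φ.toFun z := by
    intro u z
    induction z with
    | zero => simp
    | add z w hz hw => simp only [map_add, TensorProduct.tmul_add, hz, hw]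
    | tmul u v => simp
  rw [k₁, H.coassoc]
  generalize H.T₂ (p ⊗ₜ[ℂ] a) = w
  induction w with
  | zero => simp
  | add z w hz hw => simp only [map_add, TensorProduct.add_tmul, hz, hw]
  | tmul u v =>
    rw [sliceRight_tmul, dual_mul_apply, TensorProduct.assoc_tmul, LinearMap.lTensor_tmul, k₂,
      sliceRight_tmul]
    rfl

noncomputable instance : NonUnitalRing φ.dual where
  left_distrib := φ.dual_mul_add
  right_distrib := φ.dual_add_mul
  zero_mul b := by simpa using φ.dual_smul_mul 0 0 b
  mul_zero b := by simpa using φ.dual_mul_smul 0 b 0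
  mul_assoc := φ.dual_mul_assoc

instance : IsScalarTower ℂ φ.dual φ.dual := ⟨φ.dual_smul_mul⟩

instance : SMulCommClass ℂ φ.dual φ.dual := ⟨fun r b b' => (φ.dual_mul_smul r b b').symm⟩

end LeftIntegral

section Pairings

/-- The pairing `⟨a ⊗ a', b ⊗ b'⟩ = P(a, b) Q(a', b')` of tensor products. -/
noncomputable def tensorPairing {V V' W W' : Type*} [AddCommGroup V] [Module ℂ V]
    [AddCommGroup V'] [Module ℂ V'] [AddCommGroup W] [Module ℂ W] [AddCommGroup W'] [Module ℂ W']
    (P : V →ₗ[ℂ] W →ₗ[ℂ] ℂ) (Q : V' →ₗ[ℂ] W' →ₗ[ℂ] ℂ) :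
    V ⊗[ℂ] V' →ₗ[ℂ] W ⊗[ℂ] W' →ₗ[ℂ] ℂ :=
  TensorProduct.dualDistrib ℂ W W' ∘ₗ TensorProduct.map P Q

@[simp] theorem tensorPairing_tmul {V V' W W' : Type*} [AddCommGroup V] [Module ℂ V]
    [AddCommGroup V'] [Module ℂ V'] [AddCommGroup W] [Module ℂ W] [AddCommGroup W'] [Module ℂ W']
    (P : V →ₗ[ℂ] W →ₗ[ℂ] ℂ) (Q : V' →ₗ[ℂ] W' →ₗ[ℂ] ℂ) (v : V) (v' : V') (w : W) (w' : W') :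
    tensorPairing P Q (v ⊗ₜ v') (w ⊗ₜ w') = P v w * Q v' w' := by
  simp [tensorPairing]

/-- A pairing of regular multiplier Hopf algebras `A` and `B`: a non-degenerate bilinear form
`⟨·, ·⟩` on `A × B` for which the four actions (of `A` on `B` and of `B` on `A`, from the left and
from the right) exist and are unital, the product of each algebra is dual to the coproduct of the
other, and the twist `R(a ⊗ b) = ∑ ⟨a₍₂₎, b₍₁₎⟩ a₍₁₎ ⊗ b₍₂₎` is a bijection of `A ⊗ B`. The four
actions and `R` are determined by the form, because it is non-degenerate. -/
structure Pairing (HA : RegularMultiplierHopfAlgebra A) (HB : RegularMultiplierHopfAlgebra B) where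
  form : A →ₗ[ℂ] B →ₗ[ℂ] ℂ
  nondegenerate_left : ∀ a : A, (∀ b : B, form a b = 0) → a = 0
  nondegenerate_right : ∀ b : B, (∀ a : A, form a b = 0) → b = 0
  /-- The left action `(a, b) ↦ a ▹ b` of `A` on `B`. -/
  leftAB : A →ₗ[ℂ] B →ₗ[ℂ] B
  /-- The right action `(b, a) ↦ b ◃ a` of `A` on `B`. -/
  rightAB : B →ₗ[ℂ] A →ₗ[ℂ] B
  /-- The left action `(b, a) ↦ b ▹ a` of `B` on `A`. -/
  leftBA : B →ₗ[ℂ] A →ₗ[ℂ] A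
  /-- The right action `(a, b) ↦ a ◃ b` of `B` on `A`. -/
  rightBA : A →ₗ[ℂ] B →ₗ[ℂ] A
  leftAB_mul : ∀ (a a' : A) (b : B), leftAB (a * a') b = leftAB a (leftAB a' b)
  rightAB_mul : ∀ (a a' : A) (b : B), rightAB b (a * a') = rightAB (rightAB b a) a'
  leftBA_mul : ∀ (b b' : B) (a : A), leftBA (b * b') a = leftBA b (leftBA b' a)
  rightBA_mul : ∀ (b b' : B) (a : A), rightBA a (b * b') = rightBA (rightBA a b) b'
  form_leftAB : ∀ (a a' : A) (b : B), form a' (leftAB a b) = form (a' * a) b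
  form_rightAB : ∀ (a a' : A) (b : B), form a' (rightAB b a) = form (a * a') b
  form_leftBA : ∀ (a : A) (b b' : B), form (leftBA b a) b' = form a (b' * b)
  form_rightBA : ∀ (a : A) (b b' : B), form (rightBA a b) b' = form a (b * b')
  leftAB_unital : Submodule.span ℂ {y : B | ∃ (a : A) (b : B), leftAB a b = y} = ⊤
  rightAB_unital : Submodule.span ℂ {y : B | ∃ (a : A) (b : B), rightAB b a = y} = ⊤
  leftBA_unital : Submodule.span ℂ {x : A | ∃ (b : B) (a : A), leftBA b a = x} = ⊤
  rightBA_unital : Submodule.span ℂ {x : A | ∃ (b : B) (a : A), rightBA a b = x} = ⊤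
  /-- `⟨Δ(a), b ⊗ b''⟩ = ⟨a, bb''⟩` for `b'' = a' ▹ b'`, with
  `⟨Δ(a), b ⊗ (a' ▹ b')⟩ = ⟨Δ(a)(1 ⊗ a'), b ⊗ b'⟩`. -/
  form_mul_right : ∀ (a a' : A) (b b' : B),
    tensorPairing form form (HA.T₁ (a ⊗ₜ a')) (b ⊗ₜ b') = form a (b * leftAB a' b')
  /-- `⟨a'' ⊗ a', Δ(b')⟩ = ⟨a''a', b'⟩` for `a'' = a ◃ b`, with
  `⟨(a ◃ b) ⊗ a', Δ(b')⟩ = ⟨a ⊗ a', (b ⊗ 1)Δ(b')⟩`. -/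
  form_mul_left : ∀ (a a' : A) (b b' : B),
    tensorPairing form form (a ⊗ₜ a') (HB.T₂ (b ⊗ₜ b')) = form (rightBA a b * a') b'
  /-- The twist `R`, characterized by
  `⟨R(a ⊗ b), b' ⊗ a'⟩ = ∑ ⟨a, b'b₍₁₎⟩ ⟨a', b₍₂₎⟩ = ⟨a ⊗ a', (b' ⊗ 1)Δ(b)⟩`. -/
  R : A ⊗[ℂ] B ≃ₗ[ℂ] A ⊗[ℂ] B
  form_R : ∀ (a a' : A) (b b' : B),
    tensorPairing form form.flip (R (a ⊗ₜ b)) (b' ⊗ₜ a') =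
      tensorPairing form form (a ⊗ₜ a') (HB.T₂ (b' ⊗ₜ b))

end Pairings

end MultiplierHopf

/-!
A left integral `φ` is faithful: if `φ(ba) = 0` for all `b`, then the same holds for every
`(g ⊗ ι)(Δ(a)(p ⊗ 1))`, the counit vanishes on all such elements, and `a = 0` follows by applying
the counit to `Δ(a)(p ⊗ 1)`. The antipode is determined by
`S((ι ⊗ φ)(Δ(c)(1 ⊗ a))) = (ι ⊗ φ)((1 ⊗ c)Δ(a))`; every statement about right multiplication or
right invariance is the corresponding left statement for the opposite product or the opposite
product and coproduct. Each element of the dual can be written as `φ(· c)`, `φ(c ·)` and `ψ(· c)`,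
and along the last two parametrizations, up to `S`, the canonical maps of the dual are canonical
maps of `A`; this makes them bijective. The coproduct of the dual is unique because the map
`b ⊗ b' ↦ (b ⊗ 1)Δ(b')` is prescribed by the non-degenerate pairing and the action `a ◃ b`.
-/

namespace MultiplierHopf

/-! ### Tensor products and multipliers -/

section TensorProducts

variable {U V V' W W' X : Type*} [AddCommGroup U] [Module ℂ U] [AddCommGroup V] [Module ℂ V]
  [AddCommGroup V'] [Module ℂ V'] [AddCommGroup W] [Module ℂ W] [AddCommGroup W'] [Module ℂ W']
  [AddCommGroup X] [Module ℂ X]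

theorem rTensor_lTensor (f : V →ₗ[ℂ] V') (g : W →ₗ[ℂ] W') (x : V ⊗[ℂ] W) :
    f.rTensor W' (g.lTensor V x) = g.lTensor V' (f.rTensor W x) := by
  rw [← LinearMap.comp_apply, ← LinearMap.comp_apply, LinearMap.rTensor_comp_lTensor,
    LinearMap.lTensor_comp_rTensor]

theorem sliceLeft_rTensor (g : V' →ₗ[ℂ] ℂ) (f : V →ₗ[ℂ] V') (x : V ⊗[ℂ] W) :
    sliceLeft g W (f.rTensor W x) = sliceLeft (g ∘ₗ f) W x :=
  LinearMap.congr_fun (f := sliceLeft g W ∘ₗ f.rTensor W) (by ext; simp) x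

theorem sliceLeft_lTensor (g : V →ₗ[ℂ] ℂ) (f : W →ₗ[ℂ] W') (x : V ⊗[ℂ] W) :
    sliceLeft g W' (f.lTensor V x) = f (sliceLeft g W x) :=
  LinearMap.congr_fun (f := sliceLeft g W' ∘ₗ f.lTensor V) (g := f ∘ₗ sliceLeft g W)
    (by ext; simp) x

theorem sliceRight_lTensor (g : W' →ₗ[ℂ] ℂ) (f : W →ₗ[ℂ] W') (x : V ⊗[ℂ] W) :
    sliceRight V g (f.lTensor V x) = sliceRight V (g ∘ₗ f) x :=
  LinearMap.congr_fun (f := sliceRight V g ∘ₗ f.lTensor V) (by ext; simp) x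

theorem sliceRight_rTensor (g : W →ₗ[ℂ] ℂ) (f : V →ₗ[ℂ] V') (x : V ⊗[ℂ] W) :
    sliceRight V' g (f.rTensor W x) = f (sliceRight V g x) :=
  LinearMap.congr_fun (f := sliceRight V' g ∘ₗ f.rTensor W) (g := f ∘ₗ sliceRight V g)
    (by ext; simp) x

theorem sliceLeft_comm (g : W →ₗ[ℂ] ℂ) (x : V ⊗[ℂ] W) :
    sliceLeft g V (TensorProduct.comm ℂ V W x) = sliceRight V g x :=
  LinearMap.congr_fun (f := sliceLeft g V ∘ₗ (TensorProduct.comm ℂ V W).toLinearMap)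
    (by ext; simp) x

theorem sliceRight_comm (g : V →ₗ[ℂ] ℂ) (x : V ⊗[ℂ] W) :
    sliceRight W g (TensorProduct.comm ℂ V W x) = sliceLeft g W x :=
  LinearMap.congr_fun (f := sliceRight W g ∘ₗ (TensorProduct.comm ℂ V W).toLinearMap)
    (by ext; simp) x

theorem apply_sliceRight (f : V →ₗ[ℂ] ℂ) (g : W →ₗ[ℂ] ℂ) (x : V ⊗[ℂ] W) :
    f (sliceRight V g x) = g (sliceLeft f W x) :=
  LinearMap.congr_fun (f := f ∘ₗ sliceRight V g) (g := g ∘ₗ sliceLeft f W)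
    (by ext; simp [mul_comm]) x

theorem sliceLeft_surjective {g : V →ₗ[ℂ] ℂ} (hg : g ≠ 0) :
    Function.Surjective (sliceLeft g W) := by
  intro w
  obtain ⟨v, hv⟩ := g.surjective hg 1
  exact ⟨v ⊗ₜ w, by rw [sliceLeft_tmul, hv, one_smul]⟩

theorem sliceRight_surjective {g : W →ₗ[ℂ] ℂ} (hg : g ≠ 0) :
    Function.Surjective (sliceRight V g) := by
  intro v
  obtain ⟨w, hw⟩ := g.surjective hg 1
  exact ⟨v ⊗ₜ w, by rw [sliceRight_tmul, hw, one_smul]⟩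

theorem comp_ne_zero_of_surjective {f : W →ₗ[ℂ] X} (hf : f ≠ 0) {S : V →ₗ[ℂ] W}
    (hS : Function.Surjective S) : f ∘ₗ S ≠ 0 :=
  fun h => hf ((LinearMap.cancel_right hS).1 (h.trans (LinearMap.zero_comp S).symm))

theorem span_apply_tmul_eq_top {f : V ⊗[ℂ] W →ₗ[ℂ] X} (hf : Function.Surjective f) :
    Submodule.span ℂ {x : X | ∃ v w, f (v ⊗ₜ w) = x} = ⊤ := by
  rw [← LinearMap.range_eq_top.2 hf, LinearMap.range_eq_map, ← TensorProduct.span_tmul_eq_top,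
    Submodule.map_span]
  congr 1
  ext x
  simp

theorem eq_of_sliceLeft_eq {x y : V ⊗[ℂ] W} (h : ∀ g, sliceLeft g W x = sliceLeft g W y) :
    x = y := by
  rw [← sub_eq_zero]
  exact eq_zero_of_sliceLeft _ fun g => by rw [map_sub, h, sub_self]

theorem eq_of_forall_rTensor_eq {ι : Type*} (F : ι → V →ₗ[ℂ] V')
    (hF : ∀ v, (∀ i, F i v = 0) → v = 0) {x y : V ⊗[ℂ] W}
    (h : ∀ i, (F i).rTensor W x = (F i).rTensor W y) : x = y := by
  rw [← sub_eq_zero]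
  refine eq_zero_of_sliceRight _ fun f => hF _ fun i => ?_
  rw [← sliceRight_rTensor, map_sub, h, sub_self, map_zero]

theorem eq_of_forall_lTensor_eq {ι : Type*} (F : ι → W →ₗ[ℂ] W')
    (hF : ∀ w, (∀ i, F i w = 0) → w = 0) {x y : V ⊗[ℂ] W}
    (h : ∀ i, (F i).lTensor V x = (F i).lTensor V y) : x = y := by
  rw [← sub_eq_zero]
  refine eq_zero_of_sliceLeft _ fun f => hF _ fun i => ?_
  rw [← sliceLeft_lTensor, map_sub, h, sub_self, map_zero]

theorem lift_eq_zero_of_sliceLeft (Φ : V →ₗ[ℂ] W →ₗ[ℂ] X) {x : V ⊗[ℂ] W}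
    (h : ∀ (g : V →ₗ[ℂ] ℂ) (v : V), Φ v (sliceLeft g W x) = 0) : TensorProduct.lift Φ x = 0 := by
  have hx : Φ.flip.lTensor V x = 0 := eq_zero_of_sliceLeft _ fun g => by
    rw [sliceLeft_lTensor]
    exact LinearMap.ext (h g)
  rw [← map_zero (TensorProduct.lift (LinearMap.id (R := ℂ) (M := V →ₗ[ℂ] X)).flip), ← hx]
  exact LinearMap.congr_fun (g := TensorProduct.lift (LinearMap.id (R := ℂ)).flip ∘ₗ
    Φ.flip.lTensor V) (by ext; simp) x

theorem linearMap_ext_of_equiv_tensor (e : U ⊗[ℂ] V ≃ₗ[ℂ] W) {f g : W →ₗ[ℂ] X}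
    (h : ∀ u v, f (e (u ⊗ₜ v)) = g (e (u ⊗ₜ v))) : f = g :=
  (LinearMap.cancel_right e.surjective).1 (TensorProduct.ext' h)

theorem sliceLeft_assoc_tmul (g : U →ₗ[ℂ] ℂ) (x : U ⊗[ℂ] V) (w : W) :
    sliceLeft g (V ⊗[ℂ] W) (TensorProduct.assoc ℂ U V W (x ⊗ₜ w)) = sliceLeft g V x ⊗ₜ w := by
  induction x with
  | zero => simp
  | add x y hx hy => simp only [map_add, TensorProduct.add_tmul, hx, hy]
  | tmul u v => simp [TensorProduct.smul_tmul']

theorem sliceRight_assoc_symm_tmul (g : W →ₗ[ℂ] ℂ) (u : U) (x : V ⊗[ℂ] W) :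
    sliceRight (U ⊗[ℂ] V) g ((TensorProduct.assoc ℂ U V W).symm (u ⊗ₜ x)) =
      u ⊗ₜ sliceRight V g x := by
  induction x with
  | zero => simp
  | add x y hx hy => simp only [map_add, TensorProduct.tmul_add, hx, hy]
  | tmul v w => simp

theorem sliceLeft_assoc_rTensor (g : U →ₗ[ℂ] ℂ) (f : X →ₗ[ℂ] U ⊗[ℂ] V) (y : X ⊗[ℂ] W) :
    sliceLeft g (V ⊗[ℂ] W) (TensorProduct.assoc ℂ U V W (f.rTensor W y)) =
      (sliceLeft g V ∘ₗ f).rTensor W y :=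
  LinearMap.congr_fun (f := sliceLeft g (V ⊗[ℂ] W) ∘ₗ
    (TensorProduct.assoc ℂ U V W).toLinearMap ∘ₗ f.rTensor W)
    (TensorProduct.ext' fun x w => by simp [sliceLeft_assoc_tmul]) y

theorem sliceRight_assoc_symm_lTensor (g : W →ₗ[ℂ] ℂ) (f : X →ₗ[ℂ] V ⊗[ℂ] W) (y : U ⊗[ℂ] X) :
    sliceRight (U ⊗[ℂ] V) g ((TensorProduct.assoc ℂ U V W).symm (f.lTensor U y)) =
      (sliceRight V g ∘ₗ f).lTensor U y :=
  LinearMap.congr_fun (f := sliceRight (U ⊗[ℂ] V) g ∘ₗ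
    (TensorProduct.assoc ℂ U V W).symm.toLinearMap ∘ₗ f.lTensor U)
    (TensorProduct.ext' fun u x => by simp [sliceRight_assoc_symm_tmul]) y

theorem tensorPairing_tmul_left (P : V →ₗ[ℂ] W →ₗ[ℂ] ℂ) (Q : V' →ₗ[ℂ] W' →ₗ[ℂ] ℂ) (v : V)
    (v' : V') (y : W ⊗[ℂ] W') :
    tensorPairing P Q (v ⊗ₜ v') y = Q v' (sliceLeft (P v) W' y) :=
  LinearMap.congr_fun (g := Q v' ∘ₗ sliceLeft (P v) W') (by ext; simp) y

theorem tensorPairing_tmul_right (P : V →ₗ[ℂ] W →ₗ[ℂ] ℂ) (Q : V' →ₗ[ℂ] W' →ₗ[ℂ] ℂ)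
    (x : V ⊗[ℂ] V') (w : W) (w' : W') :
    tensorPairing P Q x (w ⊗ₜ w') = Q.flip w' (sliceLeft (P.flip w) V' x) :=
  LinearMap.congr_fun (f := (tensorPairing P Q).flip (w ⊗ₜ w'))
    (g := Q.flip w' ∘ₗ sliceLeft (P.flip w) V') (by ext; simp) x

theorem tensorPairing_tmul_map_right (P : V →ₗ[ℂ] W →ₗ[ℂ] ℂ) (Q : V' →ₗ[ℂ] W' →ₗ[ℂ] ℂ) (v : V)
    (v' : V') (f : U →ₗ[ℂ] W) (g : X →ₗ[ℂ] W') (y : U ⊗[ℂ] X) :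
    tensorPairing P Q (v ⊗ₜ v') (TensorProduct.map f g y) =
      P v (f (sliceRight U (Q v' ∘ₗ g) y)) :=
  LinearMap.congr_fun (f := tensorPairing P Q (v ⊗ₜ v') ∘ₗ TensorProduct.map f g)
    (g := P v ∘ₗ f ∘ₗ sliceRight U (Q v' ∘ₗ g)) (by ext; simp [mul_comm]) y

theorem tensorPairing_tmul_map_left (P : V →ₗ[ℂ] W →ₗ[ℂ] ℂ) (Q : V' →ₗ[ℂ] W' →ₗ[ℂ] ℂ) (v : V)
    (v' : V') (f : U →ₗ[ℂ] W) (g : X →ₗ[ℂ] W') (y : U ⊗[ℂ] X) :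
    tensorPairing P Q (v ⊗ₜ v') (TensorProduct.map f g y) =
      Q v' (g (sliceLeft (P v ∘ₗ f) X y)) :=
  LinearMap.congr_fun (f := tensorPairing P Q (v ⊗ₜ v') ∘ₗ TensorProduct.map f g)
    (g := Q v' ∘ₗ g ∘ₗ sliceLeft (P v ∘ₗ f) X) (by ext; simp) y

theorem tensorPairing_map_tmul (P : V →ₗ[ℂ] W →ₗ[ℂ] ℂ) (Q : V' →ₗ[ℂ] W' →ₗ[ℂ] ℂ)
    (f : U →ₗ[ℂ] V) (g : X →ₗ[ℂ] V') (y : U ⊗[ℂ] X) (w : W) (w' : W') :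
    tensorPairing P Q (TensorProduct.map f g y) (w ⊗ₜ w') =
      Q (g (sliceLeft (P.flip w ∘ₗ f) X y)) w' :=
  LinearMap.congr_fun (f := (tensorPairing P Q).flip (w ⊗ₜ w') ∘ₗ TensorProduct.map f g)
    (g := Q.flip w' ∘ₗ g ∘ₗ sliceLeft (P.flip w ∘ₗ f) X) (by ext; simp) y

theorem tensorPairing_map_map {Y Z : Type*} [AddCommGroup Y] [Module ℂ Y] [AddCommGroup Z]
    [Module ℂ Z] {P : V →ₗ[ℂ] W →ₗ[ℂ] ℂ} {P' : U →ₗ[ℂ] X →ₗ[ℂ] ℂ} {Q : V' →ₗ[ℂ] W' →ₗ[ℂ] ℂ}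
    {Q' : Y →ₗ[ℂ] Z →ₗ[ℂ] ℂ} {f : U →ₗ[ℂ] V} {g : W →ₗ[ℂ] X} {f' : Y →ₗ[ℂ] V'} {g' : W' →ₗ[ℂ] Z}
    (h : ∀ u w, P (f u) w = P' u (g w)) (h' : ∀ y w, Q (f' y) w = Q' y (g' w))
    (x : U ⊗[ℂ] Y) (w : W ⊗[ℂ] W') :
    tensorPairing P Q (TensorProduct.map f f' x) w =
      tensorPairing P' Q' x (TensorProduct.map g g' w) :=
  LinearMap.congr_fun₂ (f := tensorPairing P Q ∘ₗ TensorProduct.map f f')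
    (g := (tensorPairing P' Q').compl₂ (TensorProduct.map g g')) (by ext; simp [h, h']) x w

theorem tensorPairing_assoc_symm_tmul (P : V →ₗ[ℂ] W →ₗ[ℂ] ℂ) (Q : V' →ₗ[ℂ] W' →ₗ[ℂ] ℂ)
    (R : U →ₗ[ℂ] X →ₗ[ℂ] ℂ) (v : V) (v' : V') (u : U) (w : W) (y : W' ⊗[ℂ] X) :
    tensorPairing (tensorPairing P Q) R ((v ⊗ₜ v') ⊗ₜ u)
        ((TensorProduct.assoc ℂ W W' X).symm (w ⊗ₜ y)) =
      P v w * tensorPairing Q R (v' ⊗ₜ u) y :=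
  LinearMap.congr_fun (f := tensorPairing (tensorPairing P Q) R ((v ⊗ₜ v') ⊗ₜ u) ∘ₗ
    (TensorProduct.assoc ℂ W W' X).symm.toLinearMap ∘ₗ TensorProduct.mk ℂ W (W' ⊗[ℂ] X) w)
    (g := P v w • tensorPairing Q R (v' ⊗ₜ u)) (by ext; simp [mul_assoc]) y

theorem tensorPairing_ext_right {P : V →ₗ[ℂ] W →ₗ[ℂ] ℂ} {Q : V' →ₗ[ℂ] W' →ₗ[ℂ] ℂ}
    (hP : ∀ w, (∀ v, P v w = 0) → w = 0) (hQ : ∀ w, (∀ v, Q v w = 0) → w = 0) {y z : W ⊗[ℂ] W'}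
    (h : ∀ v v', tensorPairing P Q (v ⊗ₜ v') y = tensorPairing P Q (v ⊗ₜ v') z) : y = z := by
  rw [← sub_eq_zero]
  refine eq_zero_of_sliceRight _ fun f => hP _ fun v => ?_
  have hslice : sliceLeft (P v) W' (y - z) = 0 := hQ _ fun v' => by
    rw [← tensorPairing_tmul_left, map_sub, h, sub_self]
  rw [apply_sliceRight, hslice, map_zero]

theorem tensorPairing_ext_left {P : V →ₗ[ℂ] W →ₗ[ℂ] ℂ} {Q : V' →ₗ[ℂ] W' →ₗ[ℂ] ℂ}
    (hP : ∀ v, (∀ w, P v w = 0) → v = 0) (hQ : ∀ v, (∀ w, Q v w = 0) → v = 0) {y z : V ⊗[ℂ] V'}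
    (h : ∀ w w', tensorPairing P Q y (w ⊗ₜ w') = tensorPairing P Q z (w ⊗ₜ w')) : y = z := by
  rw [← sub_eq_zero]
  refine eq_zero_of_sliceRight _ fun f => hP _ fun w => ?_
  have hslice : sliceLeft (P.flip w) V' (y - z) = 0 := hQ _ fun w' => by
    rw [← Q.flip_apply, ← tensorPairing_tmul_right, map_sub, LinearMap.sub_apply, h, sub_self]
  rw [← P.flip_apply, apply_sliceRight, hslice, map_zero]

end TensorProducts

section Multipliers

variable {A : Type*} [NonUnitalRing A] [Module ℂ A] [SMulCommClass ℂ A A] [IsScalarTower ℂ A A]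
variable {B : Type*} [NonUnitalRing B] [Module ℂ B] [SMulCommClass ℂ B B] [IsScalarTower ℂ B B]

theorem multiplier_ext {m n : MultiplierAlgebra A} (hL : ∀ x, mulL m x = mulL n x)
    (hR : ∀ x, mulR m x = mulR n x) : m = n :=
  Subtype.ext (Prod.ext (LinearMap.ext hL) (MulOpposite.unop_injective (LinearMap.ext hR)))

theorem toMultiplier_mulL_apply (m : MultiplierAlgebra A) (x : A) :
    toMultiplier A (mulL m x) = m * toMultiplier A x :=
  multiplier_ext (fun y => by simp [mulL_map_mul]) (fun y => by simp [mulR_mul_eq])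

theorem toMultiplier_mulR_apply (m : MultiplierAlgebra A) (x : A) :
    toMultiplier A (mulR m x) = toMultiplier A x * m :=
  multiplier_ext (fun y => by simp [mulR_mul_eq]) (fun y => by simp [mulR_map_mul])

theorem mulL_tmulOne_eq (a : A) : mulL (tmulOne a) = (LinearMap.mul ℂ A a).rTensor A := rfl

theorem mulL_oneTmul_eq (a : A) : mulL (oneTmul a) = (LinearMap.mul ℂ A a).lTensor A := rfl

theorem mulR_tmulOne_eq (a : A) : mulR (tmulOne a) = ((LinearMap.mul ℂ A).flip a).rTensor A :=
  rfl

theorem mulR_oneTmul_eq (a : A) : mulR (oneTmul a) = ((LinearMap.mul ℂ A).flip a).lTensor A :=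
  rfl

theorem tmul_mul (a : A) (b : B) (x : A ⊗[ℂ] B) :
    (a ⊗ₜ b) * x = (LinearMap.mul ℂ A a).rTensor B ((LinearMap.mul ℂ B b).lTensor A x) :=
  LinearMap.congr_fun (f := LinearMap.mulLeft ℂ (a ⊗ₜ[ℂ] b))
    (g := (LinearMap.mul ℂ A a).rTensor B ∘ₗ (LinearMap.mul ℂ B b).lTensor A)
    (TensorProduct.ext' fun _ _ => by simp) x

theorem mul_tmul (a : A) (b : B) (x : A ⊗[ℂ] B) :
    x * (a ⊗ₜ b) =
      ((LinearMap.mul ℂ A).flip a).rTensor B (((LinearMap.mul ℂ B).flip b).lTensor A x) :=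
  LinearMap.congr_fun (f := LinearMap.mulRight ℂ (a ⊗ₜ[ℂ] b))
    (g := ((LinearMap.mul ℂ A).flip a).rTensor B ∘ₗ ((LinearMap.mul ℂ B).flip b).lTensor A)
    (TensorProduct.ext' fun _ _ => by simp) x

theorem tmulOne_mul_oneTmul (a b : A) :
    tmulOne a * oneTmul b = toMultiplier (A ⊗[ℂ] A) (a ⊗ₜ b) :=
  multiplier_ext (fun x => by simp [tmul_mul, mulL_tmulOne_eq, mulL_oneTmul_eq])
    (fun x => by simp [mul_tmul, mulR_tmulOne_eq, mulR_oneTmul_eq, rTensor_lTensor])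

theorem oneTmul_mul_tmulOne (a b : A) :
    oneTmul b * tmulOne a = toMultiplier (A ⊗[ℂ] A) (a ⊗ₜ b) :=
  multiplier_ext (fun x => by simp [tmul_mul, mulL_tmulOne_eq, mulL_oneTmul_eq, rTensor_lTensor])
    (fun x => by simp [mul_tmul, mulR_tmulOne_eq, mulR_oneTmul_eq])

theorem tensor_eq_of_mul_right (hA : ∀ a : A, (∀ a', a * a' = 0) → a = 0)
    (hB : ∀ b : B, (∀ b', b * b' = 0) → b = 0) {x y : A ⊗[ℂ] B}
    (h : ∀ z, x * z = y * z) : x = y := by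
  refine eq_of_forall_lTensor_eq (LinearMap.mul ℂ B).flip hB fun b => ?_
  refine eq_of_forall_rTensor_eq (LinearMap.mul ℂ A).flip hA fun a => ?_
  rw [← mul_tmul, ← mul_tmul, h]

theorem tensor_eq_of_mul_left (hA : ∀ a : A, (∀ a', a' * a = 0) → a = 0)
    (hB : ∀ b : B, (∀ b', b' * b = 0) → b = 0) {x y : A ⊗[ℂ] B}
    (h : ∀ z, z * x = z * y) : x = y := by
  refine eq_of_forall_lTensor_eq (LinearMap.mul ℂ B) hB fun b => ?_
  refine eq_of_forall_rTensor_eq (LinearMap.mul ℂ A) hA fun a => ?_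
  rw [← tmul_mul, ← tmul_mul, h]

theorem multiplier_ext_mulL (hA : ∀ a : A, (∀ a', a * a' = 0) → a = 0)
    (hB : ∀ b : B, (∀ b', b * b' = 0) → b = 0) {m n : MultiplierAlgebra (A ⊗[ℂ] B)}
    (h : ∀ x, mulL m x = mulL n x) : m = n :=
  multiplier_ext h fun x => tensor_eq_of_mul_right hA hB fun z => by
    rw [mulR_mul_eq, mulR_mul_eq, h]

theorem multiplier_ext_mulR (hA : ∀ a : A, (∀ a', a' * a = 0) → a = 0)
    (hB : ∀ b : B, (∀ b', b' * b = 0) → b = 0) {m n : MultiplierAlgebra (A ⊗[ℂ] B)}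
    (h : ∀ x, mulR m x = mulR n x) : m = n :=
  multiplier_ext (fun x => tensor_eq_of_mul_left hA hB fun z => by
    rw [← mulR_mul_eq, ← mulR_mul_eq, h]) h

end Multipliers

/-! ### Canonical maps, counit and antipode -/

/-- The canonical maps of a regular multiplier Hopf algebra, together with the maps `L a` and `R a`
that multiply by `Δ(a)` from the left and from the right. The product is a bilinear map, so that it
is possible to pass to the opposite product and to the opposite coproduct. -/
structure CanonicalMaps (A : Type*) [AddCommGroup A] [Module ℂ A] where
  mul : A →ₗ[ℂ] A →ₗ[ℂ] A
  mul_assoc : ∀ a b c, mul (mul a b) c = mul a (mul b c)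
  left_nondegenerate : ∀ a, (∀ b, mul.flip b a = 0) → a = 0
  right_nondegenerate : ∀ a, (∀ b, mul b a = 0) → a = 0
  T₁ : A ⊗[ℂ] A ≃ₗ[ℂ] A ⊗[ℂ] A
  T₂ : A ⊗[ℂ] A ≃ₗ[ℂ] A ⊗[ℂ] A
  T₃ : A ⊗[ℂ] A ≃ₗ[ℂ] A ⊗[ℂ] A
  T₄ : A ⊗[ℂ] A ≃ₗ[ℂ] A ⊗[ℂ] A
  L : A →ₗ[ℂ] A ⊗[ℂ] A →ₗ[ℂ] A ⊗[ℂ] A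
  R : A →ₗ[ℂ] A ⊗[ℂ] A →ₗ[ℂ] A ⊗[ℂ] A
  T₁_L : ∀ a c d, (mul.flip d).rTensor A (T₁ (a ⊗ₜ c)) = L a (d ⊗ₜ c)
  T₂_R : ∀ a p q, (mul q).lTensor A (T₂ (p ⊗ₜ a)) = R a (p ⊗ₜ q)
  T₃_L : ∀ a c d, (mul.flip c).lTensor A (T₃ (a ⊗ₜ d)) = L a (d ⊗ₜ c)
  T₄_R : ∀ a p q, (mul p).rTensor A (T₄ (q ⊗ₜ a)) = R a (p ⊗ₜ q)
  T₁_T₂ : ∀ a c p, (mul p).rTensor A (T₁ (a ⊗ₜ c)) = (mul.flip c).lTensor A (T₂ (p ⊗ₜ a))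
  T₁_T₄ : ∀ a c p, (mul p).lTensor A (T₁ (a ⊗ₜ c)) = (mul.flip c).lTensor A (T₄ (p ⊗ₜ a))
  T₃_T₂ : ∀ a c p, (mul p).rTensor A (T₃ (a ⊗ₜ c)) = (mul.flip c).rTensor A (T₂ (p ⊗ₜ a))
  T₃_T₄ : ∀ a c p, (mul p).lTensor A (T₃ (a ⊗ₜ c)) = (mul.flip c).rTensor A (T₄ (p ⊗ₜ a))
  L_T₁ : ∀ a b c, L a (T₁ (b ⊗ₜ c)) = T₁ (mul a b ⊗ₜ c)
  R_T₂ : ∀ a b c, R a (T₂ (c ⊗ₜ b)) = T₂ (c ⊗ₜ mul b a)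
  L_T₃ : ∀ a b c, L a (T₃ (b ⊗ₜ c)) = T₃ (mul a b ⊗ₜ c)
  R_T₄ : ∀ a b c, R a (T₄ (c ⊗ₜ b)) = T₄ (c ⊗ₜ mul b a)
  T₁_coassoc : ∀ (g : A →ₗ[ℂ] ℂ) (a b c : A), T₁ (sliceLeft g A (T₂ (a ⊗ₜ b)) ⊗ₜ c) =
    (sliceLeft g A ∘ₗ TensorProduct.curry T₂.toLinearMap a).rTensor A (T₁ (b ⊗ₜ c))
  T₂_coassoc : ∀ (g : A →ₗ[ℂ] ℂ) (a b c : A), T₂ (c ⊗ₜ sliceRight A g (T₁ (b ⊗ₜ a))) =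
    (sliceRight A g ∘ₗ (TensorProduct.curry T₁.toLinearMap).flip a).lTensor A (T₂ (c ⊗ₜ b))
  T₃_coassoc : ∀ (g : A →ₗ[ℂ] ℂ) (a b c : A), T₃ (sliceRight A g (T₄ (a ⊗ₜ b)) ⊗ₜ c) =
    (sliceRight A g ∘ₗ TensorProduct.curry T₄.toLinearMap a).lTensor A (T₃ (b ⊗ₜ c))
  T₄_coassoc : ∀ (g : A →ₗ[ℂ] ℂ) (a b c : A), T₄ (c ⊗ₜ sliceLeft g A (T₃ (b ⊗ₜ a))) =
    (sliceLeft g A ∘ₗ (TensorProduct.curry T₃.toLinearMap).flip a).rTensor A (T₄ (c ⊗ₜ b))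

namespace CanonicalMaps

variable {A : Type*} [AddCommGroup A] [Module ℂ A] (C : CanonicalMaps A)

/-- The canonical maps for the opposite product and the same coproduct. -/
def op : CanonicalMaps A where
  mul := C.mul.flip
  mul_assoc a b c := (C.mul_assoc c b a).symm
  left_nondegenerate := C.right_nondegenerate
  right_nondegenerate := C.left_nondegenerate
  T₁ := (TensorProduct.comm ℂ A A).trans C.T₄
  T₂ := (TensorProduct.comm ℂ A A).trans C.T₃
  T₃ := (TensorProduct.comm ℂ A A).trans C.T₂
  T₄ := (TensorProduct.comm ℂ A A).trans C.T₁
  L := C.R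
  R := C.L
  T₁_L a c d := C.T₄_R a d c
  T₂_R a p q := C.T₃_L a q p
  T₃_L a c d := C.T₂_R a d c
  T₄_R a p q := C.T₁_L a q p
  T₁_T₂ a c p := (C.T₃_T₄ a p c).symm
  T₁_T₄ a c p := (C.T₁_T₄ a p c).symm
  T₃_T₂ a c p := (C.T₃_T₂ a p c).symm
  T₃_T₄ a c p := (C.T₁_T₂ a p c).symm
  L_T₁ := C.R_T₄
  R_T₂ := C.L_T₃
  L_T₃ := C.R_T₂
  R_T₄ := C.L_T₁
  T₁_coassoc := C.T₄_coassoc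
  T₂_coassoc := C.T₃_coassoc
  T₃_coassoc := C.T₂_coassoc
  T₄_coassoc := C.T₁_coassoc

/-- The canonical maps for the opposite product and the opposite coproduct. -/
def opCop : CanonicalMaps A where
  mul := C.mul.flip
  mul_assoc a b c := (C.mul_assoc c b a).symm
  left_nondegenerate := C.right_nondegenerate
  right_nondegenerate := C.left_nondegenerate
  T₁ := (TensorProduct.comm ℂ A A).trans (C.T₂.trans (TensorProduct.comm ℂ A A))
  T₂ := (TensorProduct.comm ℂ A A).trans (C.T₁.trans (TensorProduct.comm ℂ A A))
  T₃ := (TensorProduct.comm ℂ A A).trans (C.T₄.trans (TensorProduct.comm ℂ A A))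
  T₄ := (TensorProduct.comm ℂ A A).trans (C.T₃.trans (TensorProduct.comm ℂ A A))
  L := (TensorProduct.comm ℂ A A).conj.toLinearMap ∘ₗ C.R
  R := (TensorProduct.comm ℂ A A).conj.toLinearMap ∘ₗ C.L
  T₁_L a c d := by simp [LinearEquiv.conj_apply, LinearMap.rTensor_comm, C.T₂_R]
  T₂_R a p q := by simp [LinearEquiv.conj_apply, LinearMap.lTensor_comm, C.T₁_L]
  T₃_L a c d := by simp [LinearEquiv.conj_apply, LinearMap.lTensor_comm, C.T₄_R]
  T₄_R a p q := by simp [LinearEquiv.conj_apply, LinearMap.rTensor_comm, C.T₃_L]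
  T₁_T₂ a c p := by simp [LinearMap.rTensor_comm, LinearMap.lTensor_comm, C.T₁_T₂]
  T₁_T₄ a c p := by simp [LinearMap.lTensor_comm, C.T₃_T₂]
  T₃_T₂ a c p := by simp [LinearMap.rTensor_comm, C.T₁_T₄]
  T₃_T₄ a c p := by simp [LinearMap.rTensor_comm, LinearMap.lTensor_comm, C.T₃_T₄]
  L_T₁ a b c := by simp [LinearEquiv.conj_apply, C.R_T₂]
  R_T₂ a b c := by simp [LinearEquiv.conj_apply, C.L_T₁]
  L_T₃ a b c := by simp [LinearEquiv.conj_apply, C.R_T₄]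
  R_T₄ a b c := by simp [LinearEquiv.conj_apply, C.L_T₃]
  T₁_coassoc g a b c := by
    simp only [LinearEquiv.trans_apply, TensorProduct.comm_tmul, sliceLeft_comm, C.T₂_coassoc,
      LinearMap.rTensor_comm]
    congr 2
    ext x
    simp [sliceLeft_comm]
  T₂_coassoc g a b c := by
    simp only [LinearEquiv.trans_apply, TensorProduct.comm_tmul, sliceRight_comm, C.T₁_coassoc,
      LinearMap.lTensor_comm]
    congr 2
    ext x
    simp [sliceRight_comm]
  T₃_coassoc g a b c := by
    simp only [LinearEquiv.trans_apply, TensorProduct.comm_tmul, sliceRight_comm, C.T₄_coassoc,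
      LinearMap.lTensor_comm]
    congr 2
    ext x
    simp [sliceRight_comm]
  T₄_coassoc g a b c := by
    simp only [LinearEquiv.trans_apply, TensorProduct.comm_tmul, sliceLeft_comm, C.T₃_coassoc,
      LinearMap.rTensor_comm]
    congr 2
    ext x
    simp [sliceLeft_comm]

@[simp] theorem opCop_mul : C.opCop.mul = C.mul.flip := rfl

@[simp] theorem op_T₁_comm (x : A ⊗[ℂ] A) : C.op.T₁ (TensorProduct.comm ℂ A A x) = C.T₄ x := by
  simp [op]

@[simp] theorem op_T₄_comm (x : A ⊗[ℂ] A) : C.op.T₄ (TensorProduct.comm ℂ A A x) = C.T₁ x := by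
  simp [op]

@[simp] theorem opCop_T₁ (x : A ⊗[ℂ] A) : C.opCop.T₁ x =
    TensorProduct.comm ℂ A A (C.T₂ (TensorProduct.comm ℂ A A x)) := rfl

@[simp] theorem opCop_T₂ (x : A ⊗[ℂ] A) : C.opCop.T₂ x =
    TensorProduct.comm ℂ A A (C.T₁ (TensorProduct.comm ℂ A A x)) := rfl

@[simp] theorem opCop_T₃ (x : A ⊗[ℂ] A) : C.opCop.T₃ x =
    TensorProduct.comm ℂ A A (C.T₄ (TensorProduct.comm ℂ A A x)) := rfl

@[simp] theorem opCop_T₄ (x : A ⊗[ℂ] A) : C.opCop.T₄ x =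
    TensorProduct.comm ℂ A A (C.T₃ (TensorProduct.comm ℂ A A x)) := rfl

/-- The multiplication `A ⊗ A → A`. -/
noncomputable def mulMap : A ⊗[ℂ] A →ₗ[ℂ] A := TensorProduct.lift C.mul

@[simp] theorem mulMap_tmul (a b : A) : C.mulMap (a ⊗ₜ b) = C.mul a b := rfl

@[simp] theorem opCop_mulMap (x : A ⊗[ℂ] A) :
    C.opCop.mulMap x = C.mulMap (TensorProduct.comm ℂ A A x) :=
  LinearMap.congr_fun (g := C.mulMap ∘ₗ (TensorProduct.comm ℂ A A).toLinearMap) (by ext; simp) x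

theorem mulMap_mul (x : A ⊗[ℂ] A) (c : A) :
    C.mul (C.mulMap x) c = C.mulMap ((C.mul.flip c).lTensor A x) :=
  LinearMap.congr_fun (f := C.mul.flip c ∘ₗ C.mulMap) (g := C.mulMap ∘ₗ (C.mul.flip c).lTensor A)
    (by ext; simp [C.mul_assoc]) x

theorem left_cancel {x y : A} (h : ∀ b, C.mul b x = C.mul b y) : x = y := by
  rw [← sub_eq_zero]
  exact C.right_nondegenerate _ fun b => by rw [map_sub, h, sub_self]

theorem right_cancel {x y : A} (h : ∀ b, C.mul x b = C.mul y b) : x = y :=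
  C.op.left_cancel h

section Counit

theorem T₁_rTensor_sliceLeft_T₂ (g : A →ₗ[ℂ] ℂ) (a : A) (y : A ⊗[ℂ] A) :
    C.T₁ ((sliceLeft g A ∘ₗ TensorProduct.curry C.T₂.toLinearMap a).rTensor A y) =
      (sliceLeft g A ∘ₗ TensorProduct.curry C.T₂.toLinearMap a).rTensor A (C.T₁ y) := by
  induction y with
  | zero => simp
  | add x y hx hy => simp only [map_add, hx, hy]
  | tmul b c => exact C.T₁_coassoc g a b c

theorem mulMap_rTensor_sliceLeft_T₂ (g : A →ₗ[ℂ] ℂ) (a : A) (y : A ⊗[ℂ] A) :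
    C.mulMap ((sliceLeft g A ∘ₗ TensorProduct.curry C.T₂.toLinearMap a).rTensor A y) =
      sliceLeft (g ∘ₗ C.mul a) A (C.T₁ y) := by
  induction y with
  | zero => simp
  | add x y hx hy => simp only [map_add, hx, hy]
  | tmul p q =>
    rw [← sliceLeft_rTensor, C.T₁_T₂, sliceLeft_lTensor]
    rfl

theorem mulMap_T₁_symm_sliceLeft_T₂ (g : A →ₗ[ℂ] ℂ) (c : A) (x : A ⊗[ℂ] A) :
    C.mulMap (C.T₁.symm (sliceLeft g A (C.T₂ x) ⊗ₜ c)) = g (C.mulMap x) • c := by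
  induction x with
  | zero => simp
  | add x y hx hy => simp only [map_add, TensorProduct.add_tmul, hx, hy, add_smul]
  | tmul a b =>
    have h := C.T₁_rTensor_sliceLeft_T₂ g a (C.T₁.symm (b ⊗ₜ c))
    rw [LinearEquiv.apply_symm_apply, ← LinearEquiv.eq_symm_apply] at h
    calc C.mulMap (C.T₁.symm (sliceLeft g A (C.T₂ (a ⊗ₜ b)) ⊗ₜ c))
      _ = sliceLeft (g ∘ₗ C.mul a) A (b ⊗ₜ c) := by
        rw [← C.T₁.apply_symm_apply (b ⊗ₜ c), ← C.mulMap_rTensor_sliceLeft_T₂, h]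
        rfl
      _ = g (C.mulMap (a ⊗ₜ b)) • c := by simp

theorem smul_mulMap_T₁_symm (g : A →ₗ[ℂ] ℂ) (u v c : A) :
    g u • C.mulMap (C.T₁.symm (v ⊗ₜ c)) = g (C.mulMap (C.T₂.symm (u ⊗ₜ v))) • c := by
  rw [← mulMap_T₁_symm_sliceLeft_T₂, LinearEquiv.apply_symm_apply, sliceLeft_tmul,
    ← TensorProduct.smul_tmul', map_smul, map_smul]

theorem exists_mulMap_symm_eq [Nontrivial A] : ∃ ε : A →ₗ[ℂ] ℂ,
    (∀ v c, C.mulMap (C.T₁.symm (v ⊗ₜ c)) = ε v • c) ∧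
      ∀ w v, C.mulMap (C.T₂.symm (w ⊗ₜ v)) = ε v • w := by
  obtain ⟨u, hu⟩ := exists_ne (0 : A)
  obtain ⟨g, hg⟩ := Module.Projective.exists_dual_eq_one ℂ hu
  let ε : A →ₗ[ℂ] ℂ := g ∘ₗ C.mulMap ∘ₗ TensorProduct.curry C.T₂.symm.toLinearMap u
  have hε₁ (v c : A) : C.mulMap (C.T₁.symm (v ⊗ₜ c)) = ε v • c := by
    simpa [ε, hg] using C.smul_mulMap_T₁_symm g u v c
  refine ⟨ε, hε₁, fun w v => ?_⟩
  rw [← sub_eq_zero, ← Module.forall_dual_apply_eq_zero_iff ℂ]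
  intro f
  have h : (f w * ε v) • u = f (C.mulMap (C.T₂.symm (w ⊗ₜ v))) • u := by
    rw [← C.smul_mulMap_T₁_symm f w v u, hε₁, smul_smul]
  rw [map_sub, map_smul, smul_eq_mul, mul_comm, smul_left_injective ℂ hu h, sub_self]

/-- `ε` is the counit, as a linear functional. -/
structure IsCounit (ε : A →ₗ[ℂ] ℂ) : Prop where
  T₁ : ∀ x, sliceLeft ε A (C.T₁ x) = C.mulMap x
  T₂ : ∀ x, sliceRight A ε (C.T₂ x) = C.mulMap x

theorem exists_isCounit [Nontrivial A] : ∃ ε, C.IsCounit ε := by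
  obtain ⟨ε, hε₁, hε₂⟩ := C.exists_mulMap_symm_eq
  refine ⟨ε, fun x => ?_, fun x => ?_⟩
  · exact LinearMap.congr_fun (f := sliceLeft ε A ∘ₗ C.T₁.toLinearMap)
      (linearMap_ext_of_equiv_tensor C.T₁.symm fun v c => by simp [hε₁]) x
  · exact LinearMap.congr_fun (f := sliceRight A ε ∘ₗ C.T₂.toLinearMap)
      (linearMap_ext_of_equiv_tensor C.T₂.symm fun w v => by simp [hε₂]) x

namespace IsCounit

variable {C} {ε : A →ₗ[ℂ] ℂ}

theorem sliceLeft_L (hε : C.IsCounit ε) (a : A) (x : A ⊗[ℂ] A) :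
    sliceLeft ε A (C.L a x) = C.mul a (sliceLeft ε A x) :=
  LinearMap.congr_fun (f := sliceLeft ε A ∘ₗ C.L a) (g := C.mul a ∘ₗ sliceLeft ε A)
    (linearMap_ext_of_equiv_tensor C.T₁ fun b c => by simp [C.L_T₁, hε.T₁, C.mul_assoc]) x

theorem sliceLeft_rTensor_mul (hε : C.IsCounit ε) (p : A) (y : A ⊗[ℂ] A) :
    sliceLeft ε A ((C.mul.flip p).rTensor A y) = ε p • sliceLeft ε A y :=
  LinearMap.congr_fun (f := sliceLeft ε A ∘ₗ (C.mul.flip p).rTensor A) (g := ε p • sliceLeft ε A)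
    (linearMap_ext_of_equiv_tensor C.T₁ fun a q => by simp [C.T₁_L, hε.sliceLeft_L, hε.T₁]) y

theorem map_mul (hε : C.IsCounit ε) (a b : A) : ε (C.mul a b) = ε a * ε b := by
  rcases eq_or_ne a 0 with rfl | ha
  · simp
  · have h := hε.sliceLeft_rTensor_mul b (a ⊗ₜ a)
    simp only [LinearMap.rTensor_tmul, LinearMap.flip_apply, sliceLeft_tmul, smul_smul] at h
    rw [smul_left_injective ℂ ha h, mul_comm]

theorem T₃ (hε : C.IsCounit ε) (x : A ⊗[ℂ] A) : sliceRight A ε (C.T₃ x) = C.mulMap x := by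
  induction x with
  | zero => simp
  | add x y hx hy => simp only [map_add, hx, hy]
  | tmul a b =>
    refine C.left_cancel fun c => ?_
    rw [← sliceRight_rTensor, C.T₃_T₂, sliceRight_rTensor, hε.T₂, mulMap_tmul, mulMap_tmul,
      LinearMap.flip_apply, C.mul_assoc]

theorem opCop (hε : C.IsCounit ε) : C.opCop.IsCounit ε where
  T₁ x := by simp [sliceLeft_comm, hε.T₂]
  T₂ x := by simp [sliceRight_comm, hε.T₁]

theorem ne_zero [Nontrivial A] (hε : C.IsCounit ε) : ε ≠ 0 := by
  rintro rfl
  obtain ⟨a, ha⟩ := exists_ne (0 : A)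
  refine ha (C.left_nondegenerate a fun b => ?_)
  rw [LinearMap.flip_apply, ← mulMap_tmul, ← hε.T₁]
  simp [sliceLeft]

end IsCounit

theorem mulMap_surjective [Nontrivial A] : Function.Surjective C.mulMap := by
  obtain ⟨ε, hε⟩ := C.exists_isCounit
  intro a
  obtain ⟨x, rfl⟩ := ((sliceLeft_surjective hε.ne_zero).comp C.T₁.surjective) a
  exact ⟨x, (hε.T₁ x).symm⟩

end Counit

section Antipode

/-- `S` is the antipode, `ε` being the counit. -/
structure IsAntipode (ε : A →ₗ[ℂ] ℂ) (S : A →ₗ[ℂ] A) : Prop where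
  T₁ : ∀ x, C.mulMap (S.rTensor A (C.T₁ x)) = sliceLeft ε A x
  T₂ : ∀ x, C.mulMap (S.lTensor A (C.T₂ x)) = sliceRight A ε x

namespace IsAntipode

variable {C} {ε : A →ₗ[ℂ] ℂ} {S : A →ₗ[ℂ] A}

theorem mul_eq (hS : C.IsAntipode ε S) (a b : A) :
    C.mul (S a) b = sliceLeft ε A (C.T₁.symm (a ⊗ₜ b)) := by
  rw [← hS.T₁, LinearEquiv.apply_symm_apply]
  rfl

theorem opCop (hS : C.IsAntipode ε S) : C.opCop.IsAntipode ε S where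
  T₁ x := by simp [LinearMap.rTensor_comm, hS.T₂, sliceRight_comm]
  T₂ x := by simp [LinearMap.lTensor_comm, hS.T₁, sliceLeft_comm]

theorem mulMap_rTensor_L (hε : C.IsCounit ε) (hS : C.IsAntipode ε S) (a : A) (x : A ⊗[ℂ] A) :
    C.mulMap (S.rTensor A (C.L a x)) = ε a • C.mulMap (S.rTensor A x) :=
  LinearMap.congr_fun (f := C.mulMap ∘ₗ S.rTensor A ∘ₗ C.L a)
    (g := ε a • (C.mulMap ∘ₗ S.rTensor A))
    (linearMap_ext_of_equiv_tensor C.T₁ fun b c => by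
      simp [C.L_T₁, hS.T₁, hε.map_mul, smul_smul]) x

theorem mulMap_rTensor_rTensor_mul (hε : C.IsCounit ε) (hS : C.IsAntipode ε S) (b : A)
    (x : A ⊗[ℂ] A) : C.mulMap (S.rTensor A ((C.mul.flip b).rTensor A x)) =
      C.mul (S b) (C.mulMap (S.rTensor A x)) :=
  LinearMap.congr_fun (f := C.mulMap ∘ₗ S.rTensor A ∘ₗ (C.mul.flip b).rTensor A)
    (g := C.mul (S b) ∘ₗ C.mulMap ∘ₗ S.rTensor A)
    (linearMap_ext_of_equiv_tensor C.T₁ fun p q => by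
      simp [C.T₁_L, hS.mulMap_rTensor_L hε, hS.T₁]) x

theorem map_mul (hε : C.IsCounit ε) (hS : C.IsAntipode ε S) (a b : A) :
    S (C.mul a b) = C.mul (S b) (S a) :=
  C.right_cancel fun c => by
    rw [C.mul_assoc]
    exact hS.mulMap_rTensor_rTensor_mul hε b (a ⊗ₜ c)

theorem T₃ (hε : C.IsCounit ε) (hS : C.IsAntipode ε S) (a b : A) :
    C.mulMap (S.rTensor A (C.T₃ (a ⊗ₜ b))) = ε a • S b := by
  refine C.right_cancel fun c => ?_
  rw [mulMap_mul, ← rTensor_lTensor, C.T₃_L, hS.mulMap_rTensor_L hε]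
  simp

end IsAntipode

end Antipode

end CanonicalMaps

/-! ### Invariant functionals -/

namespace CanonicalMaps

variable {A : Type*} [AddCommGroup A] [Module ℂ A] (C : CanonicalMaps A)

/-- The functional `φ` is left invariant: `(ι ⊗ φ)Δ(a) = φ(a)1`. -/
structure IsLeftInvariant (φ : A →ₗ[ℂ] ℂ) : Prop where
  T₂ : ∀ a b, sliceRight A φ (C.T₂ (b ⊗ₜ a)) = φ a • b
  T₃ : ∀ a b, sliceRight A φ (C.T₃ (a ⊗ₜ b)) = φ a • b

/-- The functional `ψ` is right invariant: `(ψ ⊗ ι)Δ(a) = ψ(a)1`. -/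
structure IsRightInvariant (ψ : A →ₗ[ℂ] ℂ) : Prop where
  T₁ : ∀ a b, sliceLeft ψ A (C.T₁ (a ⊗ₜ b)) = ψ a • b
  T₄ : ∀ a b, sliceLeft ψ A (C.T₄ (b ⊗ₜ a)) = ψ a • b

/-- The map `a ↦ (ι ⊗ φ)(Δ(c)(1 ⊗ a))`. -/
noncomputable def sliceT₁ (φ : A →ₗ[ℂ] ℂ) (c : A) : A →ₗ[ℂ] A :=
  sliceRight A φ ∘ₗ TensorProduct.curry C.T₁.toLinearMap c

theorem sliceT₁_apply (φ : A →ₗ[ℂ] ℂ) (c a : A) :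
    C.sliceT₁ φ c a = sliceRight A φ (C.T₁ (c ⊗ₜ a)) := rfl

theorem mul_sliceRight_T₁ (φ : A →ₗ[ℂ] ℂ) (d c a : A) :
    C.mul d (sliceRight A φ (C.T₁ (c ⊗ₜ a))) =
      sliceRight A (φ ∘ₗ C.mul.flip a) (C.T₂ (d ⊗ₜ c)) := by
  rw [← sliceRight_rTensor, C.T₁_T₂, sliceRight_lTensor]

theorem rTensor_T₁_sliceT₁ (φ : A →ₗ[ℂ] ℂ) (c d : A) (x : A ⊗[ℂ] A) :
    (C.mul d).rTensor A (C.T₁ ((C.sliceT₁ φ c).rTensor A (TensorProduct.comm ℂ A A x))) =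
      (sliceRight A φ ∘ₗ C.L.flip x).lTensor A (C.T₂ (d ⊗ₜ c)) := by
  induction x with
  | zero => simp
  | add x y hx hy =>
    simp only [map_add, hx, hy, LinearMap.comp_add, LinearMap.lTensor_add, LinearMap.add_apply]
  | tmul p q =>
    rw [TensorProduct.comm_tmul, LinearMap.rTensor_tmul, C.T₁_T₂, sliceT₁_apply, C.T₂_coassoc,
      ← LinearMap.lTensor_comp_apply]
    congr 2
    ext s
    simp only [LinearMap.comp_apply, LinearMap.flip_apply, ← C.T₁_L, sliceRight_rTensor,
      TensorProduct.curry_apply, LinearEquiv.coe_coe]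

variable {C} {φ ψ ε : A →ₗ[ℂ] ℂ} {S : A →ₗ[ℂ] A}

theorem IsCounit.comp_sliceT₁ (hε : C.IsCounit ε) (φ : A →ₗ[ℂ] ℂ) (c : A) :
    ε ∘ₗ C.sliceT₁ φ c = φ ∘ₗ C.mul c := by
  ext a
  rw [LinearMap.comp_apply, sliceT₁_apply, apply_sliceRight, hε.T₁]
  rfl

namespace IsLeftInvariant

theorem op (hφ : C.IsLeftInvariant φ) : C.op.IsLeftInvariant φ := ⟨hφ.T₃, hφ.T₂⟩

/-- In Sweedler notation, `c₍₁₎ ⊗ φ(c₍₃₎a₍₂₎)c₍₂₎a₍₁₎b = c₍₁₎ ⊗ φ(c₍₂₎a)b`. -/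
theorem T₁_sliceT₁ (hφ : C.IsLeftInvariant φ) (c : A) (z : A ⊗[ℂ] A) :
    C.T₁ ((C.sliceT₁ φ c).rTensor A (TensorProduct.comm ℂ A A (C.T₃ z))) =
      (C.sliceT₁ φ c).rTensor A z := by
  induction z with
  | zero => simp
  | add x y hx hy => simp only [map_add, hx, hy]
  | tmul a b =>
    refine eq_of_forall_rTensor_eq C.mul C.right_nondegenerate fun d => ?_
    rw [C.rTensor_T₁_sliceT₁, LinearMap.rTensor_tmul, LinearMap.rTensor_tmul, sliceT₁_apply,
      mul_sliceRight_T₁]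
    generalize C.T₂ (d ⊗ₜ c) = w
    induction w with
    | zero => simp
    | add x y hx hy => simp only [map_add, hx, hy, TensorProduct.add_tmul]
    | tmul r s => simp [C.L_T₃, hφ.T₃, TensorProduct.smul_tmul]

theorem sliceLeft_T₁_symm_sliceRight_T₁ (hφ : C.IsLeftInvariant φ) (hε : C.IsCounit ε)
    (x : A ⊗[ℂ] A) (b : A) :
    sliceLeft ε A (C.T₁.symm (sliceRight A φ (C.T₁ x) ⊗ₜ b)) =
      C.mul (sliceRight A φ (C.T₄ x)) b := by
  induction x with
  | zero => simp
  | add x y hx hy => simp only [map_add, hx, hy, TensorProduct.add_tmul, LinearMap.add_apply]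
  | tmul c a =>
    have h := hφ.T₁_sliceT₁ c (a ⊗ₜ b)
    rw [LinearMap.rTensor_tmul, sliceT₁_apply] at h
    rw [← h, LinearEquiv.symm_apply_apply, sliceLeft_rTensor, sliceLeft_comm, hε.comp_sliceT₁,
      ← sliceRight_lTensor, C.T₃_T₄, sliceRight_rTensor]
    rfl

theorem exists_mul_eq (hφ : C.IsLeftInvariant φ) (h0 : φ ≠ 0) (hε : C.IsCounit ε) :
    ∃ S : A →ₗ[ℂ] A, ∀ p b, C.mul (S p) b = sliceLeft ε A (C.T₁.symm (p ⊗ₜ b)) := by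
  obtain ⟨u, hu⟩ := φ.surjective h0 1
  refine ⟨sliceRight A φ ∘ₗ C.T₄.toLinearMap ∘ₗ
    (TensorProduct.curry C.T₁.symm.toLinearMap).flip u, fun p b => ?_⟩
  have h := hφ.sliceLeft_T₁_symm_sliceRight_T₁ hε (C.T₁.symm (p ⊗ₜ u)) b
  rw [LinearEquiv.apply_symm_apply, sliceRight_tmul, hu, one_smul] at h
  exact h.symm

theorem map_sliceRight_T₁ (hφ : C.IsLeftInvariant φ) (hε : C.IsCounit ε)
    (hS : ∀ p b, C.mul (S p) b = sliceLeft ε A (C.T₁.symm (p ⊗ₜ b))) (x : A ⊗[ℂ] A) :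
    S (sliceRight A φ (C.T₁ x)) = sliceRight A φ (C.T₄ x) :=
  C.right_cancel fun b => by rw [hS, hφ.sliceLeft_T₁_symm_sliceRight_T₁ hε]

theorem mulMap_lTensor_T₂ (hφ : C.IsLeftInvariant φ) (hε : C.IsCounit ε)
    (hS : ∀ x, S (sliceRight A φ (C.T₁ x)) = sliceRight A φ (C.T₄ x)) (a : A) (x : A ⊗[ℂ] A) :
    C.mulMap (S.lTensor A (C.T₂ (a ⊗ₜ sliceRight A φ (C.T₁ x)))) =
      ε (sliceRight A φ (C.T₁ x)) • a := by
  induction x with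
  | zero => simp
  | add x y hx hy => simp only [map_add, TensorProduct.tmul_add, hx, hy, add_smul]
  | tmul b q =>
    have hslice (w : A ⊗[ℂ] A) : C.mulMap (S.lTensor A ((sliceRight A φ ∘ₗ
        (TensorProduct.curry C.T₁.toLinearMap).flip q).lTensor A w)) =
        sliceRight A φ (C.R q w) := by
      induction w with
      | zero => simp
      | add x y hx hy => simp only [map_add, hx, hy]
      | tmul r s => simp [← C.T₄_R, sliceRight_rTensor, hS]
    rw [C.T₂_coassoc, hslice, C.R_T₂, hφ.T₂, apply_sliceRight, hε.T₁]
    rfl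

theorem exists_isAntipode (hφ : C.IsLeftInvariant φ) (h0 : φ ≠ 0) (hε : C.IsCounit ε) :
    ∃ S : A →ₗ[ℂ] A, C.IsAntipode ε S := by
  obtain ⟨S, hS⟩ := hφ.exists_mul_eq h0 hε
  refine ⟨S, fun x => ?_, fun x => ?_⟩
  · exact LinearMap.congr_fun (f := C.mulMap ∘ₗ S.rTensor A ∘ₗ C.T₁.toLinearMap)
      (linearMap_ext_of_equiv_tensor C.T₁.symm fun p b => by simp [hS]) x
  · induction x with
    | zero => simp
    | add x y hx hy => simp only [map_add, hx, hy]
    | tmul a b =>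
      obtain ⟨x, rfl⟩ := ((sliceRight_surjective h0).comp C.T₁.surjective) b
      rw [sliceRight_tmul]
      exact hφ.mulMap_lTensor_T₂ hε (hφ.map_sliceRight_T₁ hε hS) a x

theorem antipode_sliceRight_T₁ (hφ : C.IsLeftInvariant φ) (hε : C.IsCounit ε)
    (hS : C.IsAntipode ε S) (x : A ⊗[ℂ] A) :
    S (sliceRight A φ (C.T₁ x)) = sliceRight A φ (C.T₄ x) :=
  hφ.map_sliceRight_T₁ hε hS.mul_eq x

/-- The antipode for the opposite product is the inverse. -/
theorem antipode_bijective [Nontrivial A] (hφ : C.IsLeftInvariant φ) (h0 : φ ≠ 0)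
    (hε : C.IsCounit ε) (hS : C.IsAntipode ε S) : Function.Bijective S := by
  obtain ⟨ε', hε'⟩ := C.op.exists_isCounit
  obtain ⟨S', hS'⟩ := hφ.op.exists_isAntipode h0 hε'
  have h := hφ.antipode_sliceRight_T₁ hε hS
  have h' (x : A ⊗[ℂ] A) : S' (sliceRight A φ (C.T₄ x)) = sliceRight A φ (C.T₁ x) := by
    simpa using hφ.op.antipode_sliceRight_T₁ hε' hS' (TensorProduct.comm ℂ A A x)
  refine Function.bijective_iff_has_inverse.mpr ⟨S', fun a => ?_, fun a => ?_⟩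
  · obtain ⟨x, rfl⟩ := ((sliceRight_surjective h0).comp C.T₁.surjective) a
    rw [Function.comp_apply, h, h']
  · obtain ⟨x, rfl⟩ := ((sliceRight_surjective h0).comp C.T₄.surjective) a
    rw [Function.comp_apply, h', h]

theorem apply_mul_sliceLeft_T₃_eq_zero (hφ : C.IsLeftInvariant φ) (hε : C.IsCounit ε)
    (hS : C.IsAntipode ε S) {a : A} (ha : ∀ b, φ (C.mul b a) = 0) (g : A →ₗ[ℂ] ℂ) (p b : A) :
    φ (C.mul b (sliceLeft g A (C.T₃ (a ⊗ₜ p)))) = 0 := by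
  have hslice : sliceRight A φ (C.T₁ (b ⊗ₜ a)) = 0 := C.left_cancel fun c => by
    have ha' : φ ∘ₗ C.mul.flip a = 0 := LinearMap.ext ha
    rw [mul_sliceRight_T₁, ha']
    simp [sliceRight]
  rw [← sliceLeft_lTensor, ← apply_sliceRight, C.T₃_T₄, sliceRight_rTensor,
    ← hφ.antipode_sliceRight_T₁ hε hS, hslice, map_zero, map_zero, map_zero]

/-- Otherwise `ε(a)φ(bS(p)) = φ(bS(a₍₁₎p)a₍₂₎) = 0` would force `φ = 0`. -/
theorem counit_eq_zero [Nontrivial A] (hφ : C.IsLeftInvariant φ) (h0 : φ ≠ 0)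
    (hε : C.IsCounit ε) (hS : C.IsAntipode ε S) {a : A} (ha : ∀ b, φ (C.mul b a) = 0) :
    ε a = 0 := by
  have hzero (b p : A) : ε a * φ (C.mul b (S p)) = 0 := by
    have h := lift_eq_zero_of_sliceLeft ((C.mul.compr₂ (φ ∘ₗ C.mul b)) ∘ₗ S)
      (x := C.T₃ (a ⊗ₜ p)) fun g v => by
        simpa [← C.mul_assoc] using hφ.apply_mul_sliceLeft_T₃_eq_zero hε hS ha g p (C.mul b (S v))
    have hlift : TensorProduct.lift ((C.mul.compr₂ (φ ∘ₗ C.mul b)) ∘ₗ S) =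
        φ ∘ₗ C.mul b ∘ₗ C.mulMap ∘ₗ S.rTensor A := by ext; simp
    simpa [hlift, hS.T₃ hε] using h
  by_contra hne
  refine h0 ((LinearMap.cancel_right C.mulMap_surjective).1 (TensorProduct.ext' fun b q => ?_))
  obtain ⟨p, rfl⟩ := (hφ.antipode_bijective h0 hε hS).surjective q
  simpa [hne] using hzero b p

theorem eq_zero_of_apply_mul_right [Nontrivial A] (hφ : C.IsLeftInvariant φ) (h0 : φ ≠ 0) {a : A}
    (ha : ∀ b, φ (C.mul b a) = 0) : a = 0 := by
  obtain ⟨ε, hε⟩ := C.exists_isCounit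
  obtain ⟨S, hS⟩ := hφ.exists_isAntipode h0 hε
  refine C.left_nondegenerate a fun p => ?_
  rw [LinearMap.flip_apply, ← mulMap_tmul, ← hε.T₃, ← Module.forall_dual_apply_eq_zero_iff ℂ]
  intro g
  rw [apply_sliceRight]
  exact hφ.counit_eq_zero h0 hε hS (hφ.apply_mul_sliceLeft_T₃_eq_zero hε hS ha g p)

theorem eq_zero_of_apply_mul_left [Nontrivial A] (hφ : C.IsLeftInvariant φ) (h0 : φ ≠ 0) {a : A}
    (ha : ∀ b, φ (C.mul a b) = 0) : a = 0 :=
  hφ.op.eq_zero_of_apply_mul_right h0 ha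

/-- The functional `(φ ⊗ g)((1 ⊗ c)Δ(·))` is left invariant with `φ`. -/
theorem sliceRight_T₃_comp_sliceRight_T₄ (hφ : C.IsLeftInvariant φ) (g : A →ₗ[ℂ] ℂ) (c : A)
    (z : A ⊗[ℂ] A) :
    sliceRight A (φ ∘ₗ sliceRight A g ∘ₗ TensorProduct.curry C.T₄.toLinearMap c) (C.T₃ z) =
      sliceLeft (φ ∘ₗ sliceRight A g ∘ₗ TensorProduct.curry C.T₄.toLinearMap c) A z := by
  induction z with
  | zero => simp
  | add x y hx hy => simp only [map_add, hx, hy]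
  | tmul a b => rw [← sliceRight_lTensor, ← C.T₃_coassoc, hφ.T₃, sliceLeft_tmul]; rfl

theorem sliceLeft_comp_antipode_T₁ (hφ : C.IsLeftInvariant φ) (h0 : φ ≠ 0) (hε : C.IsCounit ε)
    (hS : C.IsAntipode ε S) (a b : A) :
    sliceLeft (φ ∘ₗ S) A (C.T₁ (a ⊗ₜ b)) = φ (S a) • b := by
  obtain ⟨x, rfl⟩ := ((sliceRight_surjective h0).comp C.T₁.surjective) a
  rw [Function.comp_apply]
  induction x with
  | zero => simp
  | add x y hx hy => simp only [map_add, hx, hy, TensorProduct.add_tmul, add_smul]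
  | tmul c a =>
    have hcomp : S ∘ₗ C.sliceT₁ φ c = sliceRight A φ ∘ₗ TensorProduct.curry C.T₄.toLinearMap c :=
      LinearMap.ext fun p => hφ.antipode_sliceRight_T₁ hε hS (c ⊗ₜ p)
    have hT₁ := hφ.T₁_sliceT₁ c (C.T₃.symm (b ⊗ₜ a))
    have hT₃ := hφ.sliceRight_T₃_comp_sliceRight_T₄ φ c (C.T₃.symm (b ⊗ₜ a))
    rw [LinearEquiv.apply_symm_apply] at hT₁ hT₃
    rw [TensorProduct.comm_tmul, LinearMap.rTensor_tmul, sliceT₁_apply] at hT₁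
    rw [hT₁, sliceLeft_rTensor, LinearMap.comp_assoc, hcomp, ← hT₃, sliceRight_tmul,
      hφ.antipode_sliceRight_T₁ hε hS]
    rfl

theorem comp_antipode (hφ : C.IsLeftInvariant φ) (h0 : φ ≠ 0) (hε : C.IsCounit ε)
    (hS : C.IsAntipode ε S) : C.IsRightInvariant (φ ∘ₗ S) where
  T₁ := hφ.sliceLeft_comp_antipode_T₁ h0 hε hS
  T₄ a b := C.right_cancel fun c => by
    rw [← C.mul.flip_apply, ← sliceLeft_lTensor, ← C.T₁_T₄, sliceLeft_lTensor,
      hφ.sliceLeft_comp_antipode_T₁ h0 hε hS]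
    simp

end IsLeftInvariant

namespace IsRightInvariant

theorem opCop (hψ : C.IsRightInvariant ψ) : C.opCop.IsLeftInvariant ψ where
  T₂ a b := by simp [sliceRight_comm, hψ.T₁]
  T₃ a b := by simp [sliceRight_comm, hψ.T₄]

theorem antipode_sliceLeft_T₂ (hψ : C.IsRightInvariant ψ) (hε : C.IsCounit ε)
    (hS : C.IsAntipode ε S) (x : A ⊗[ℂ] A) :
    S (sliceLeft ψ A (C.T₂ x)) = sliceLeft ψ A (C.T₃ x) := by
  simpa [sliceRight_comm] using
    hψ.opCop.antipode_sliceRight_T₁ hε.opCop hS.opCop (TensorProduct.comm ℂ A A x)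

end IsRightInvariant

section LeftAndRightInvariant

/-- Both sides are `(ψ ⊗ φ)(Δ(a)x)`. -/
theorem apply_mul_sliceRight_T₁_symm (hφ : C.IsLeftInvariant φ) (hψ : C.IsRightInvariant ψ)
    (x : A ⊗[ℂ] A) (a : A) :
    ψ (C.mul a (sliceRight A φ (C.T₁.symm x))) = φ (C.mul a (sliceRight A ψ (C.T₃.symm x))) := by
  have h₁ : φ ∘ₗ sliceLeft ψ A ∘ₗ C.L a ∘ₗ C.T₁.toLinearMap = ψ ∘ₗ C.mul a ∘ₗ sliceRight A φ :=
    TensorProduct.ext' fun p q => by simp [C.L_T₁, hψ.T₁, mul_comm]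
  have h₃ : φ ∘ₗ sliceLeft ψ A ∘ₗ C.L a ∘ₗ C.T₃.toLinearMap = φ ∘ₗ C.mul a ∘ₗ sliceRight A ψ :=
    TensorProduct.ext' fun p q => by simp [C.L_T₃, ← apply_sliceRight, hφ.T₃, mul_comm]
  simpa using (LinearMap.congr_fun h₁ (C.T₁.symm x)).symm.trans
    (by simpa using LinearMap.congr_fun h₃ (C.T₃.symm x))

theorem exists_apply_mul_right_eq_of_isLeftInvariant (hφ : C.IsLeftInvariant φ)
    (hψ : C.IsRightInvariant ψ) (h0 : ψ ≠ 0) (c : A) :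
    ∃ d, ∀ a, φ (C.mul a c) = ψ (C.mul a d) := by
  obtain ⟨x, rfl⟩ := ((sliceRight_surjective h0).comp C.T₃.symm.surjective) c
  exact ⟨_, fun a => (apply_mul_sliceRight_T₁_symm hφ hψ x a).symm⟩

theorem exists_apply_mul_right_eq_of_isRightInvariant (hφ : C.IsLeftInvariant φ)
    (hψ : C.IsRightInvariant ψ) (h0 : φ ≠ 0) (c : A) :
    ∃ d, ∀ a, ψ (C.mul a c) = φ (C.mul a d) := by
  obtain ⟨x, rfl⟩ := ((sliceRight_surjective h0).comp C.T₁.symm.surjective) c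
  exact ⟨_, fun a => apply_mul_sliceRight_T₁_symm hφ hψ x a⟩

/-- Both sides are `(ψ ⊗ φ)((1 ⊗ S(q))Δ(x)(S(p) ⊗ 1))` for `w = p ⊗ q`. -/
theorem apply_mul_sliceLeft_T₂ (hφ : C.IsLeftInvariant φ) (hψ : C.IsRightInvariant ψ)
    (hε : C.IsCounit ε) (hS : C.IsAntipode ε S) (w : A ⊗[ℂ] A) (x : A) :
    φ (C.mul (sliceLeft (ψ ∘ₗ S) A (C.T₂ (S.lTensor A w))) x) =
      ψ (C.mul x (sliceRight A (φ ∘ₗ S) (C.T₁ (S.rTensor A w)))) := by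
  induction w with
  | zero => simp
  | add x y hx hy => simp only [map_add, LinearMap.add_apply, hx, hy]
  | tmul p q =>
    rw [LinearMap.lTensor_tmul, LinearMap.rTensor_tmul]
    calc φ (C.mul (sliceLeft (ψ ∘ₗ S) A (C.T₂ (p ⊗ₜ S q))) x)
      _ = ψ (S (C.mul p (sliceRight A φ (C.T₁ (S q ⊗ₜ x))))) := by
        rw [← C.mul.flip_apply, ← sliceLeft_lTensor, ← C.T₁_T₂, ← apply_sliceRight,
          sliceRight_rTensor, LinearMap.comp_apply]
      _ = ψ (C.mul (sliceRight A φ (C.T₄ (S q ⊗ₜ x))) (S p)) := by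
        rw [hS.map_mul hε, hφ.antipode_sliceRight_T₁ hε hS]
      _ = φ (C.mul (S q) (sliceLeft ψ A (C.T₃ (x ⊗ₜ S p)))) := by
        rw [← C.mul.flip_apply, ← sliceRight_rTensor, ← C.T₃_T₄, apply_sliceRight,
          sliceLeft_lTensor]
      _ = φ (S (C.mul (sliceLeft ψ A (C.T₂ (x ⊗ₜ S p))) q)) := by
        rw [hS.map_mul hε, hψ.antipode_sliceLeft_T₂ hε hS]
      _ = ψ (C.mul x (sliceRight A (φ ∘ₗ S) (C.T₁ (S p ⊗ₜ q)))) := by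
        rw [← sliceRight_rTensor, C.T₁_T₂, apply_sliceRight, sliceLeft_lTensor,
          LinearMap.comp_apply, LinearMap.flip_apply]

theorem exists_apply_mul_left_eq (hφ : C.IsLeftInvariant φ) (hψ : C.IsRightInvariant ψ)
    (hψ0 : ψ ≠ 0) (hε : C.IsCounit ε) (hS : C.IsAntipode ε S) (hS' : Function.Surjective S)
    (c : A) : ∃ d, ∀ x, φ (C.mul c x) = ψ (C.mul x d) := by
  obtain ⟨w, rfl⟩ := (((sliceLeft_surjective (comp_ne_zero_of_surjective hψ0 hS')).comp
    C.T₂.surjective).comp (LinearMap.lTensor_surjective A hS')) c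
  exact ⟨_, apply_mul_sliceLeft_T₂ hφ hψ hε hS w⟩

theorem exists_apply_mul_right_eq (hφ : C.IsLeftInvariant φ) (hψ : C.IsRightInvariant ψ)
    (hφ0 : φ ≠ 0) (hε : C.IsCounit ε) (hS : C.IsAntipode ε S) (hS' : Function.Surjective S)
    (d : A) : ∃ c, ∀ x, ψ (C.mul x d) = φ (C.mul c x) := by
  obtain ⟨w, rfl⟩ := (((sliceRight_surjective (comp_ne_zero_of_surjective hφ0 hS')).comp
    C.T₁.surjective).comp (LinearMap.rTensor_surjective A hS')) d
  exact ⟨_, fun x => (apply_mul_sliceLeft_T₂ hφ hψ hε hS w x).symm⟩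

end LeftAndRightInvariant

end CanonicalMaps

/-! ### Regular multiplier Hopf algebras -/

namespace RegularMultiplierHopfAlgebra

variable {A : Type*} [NonUnitalRing A] [Module ℂ A] [SMulCommClass ℂ A A] [IsScalarTower ℂ A A]
  (H : RegularMultiplierHopfAlgebra A)

theorem mul_rTensor_T₁ (a c p : A) : (LinearMap.mul ℂ A p).rTensor A (H.T₁ (a ⊗ₜ c)) =
    ((LinearMap.mul ℂ A).flip c).lTensor A (H.T₂ (p ⊗ₜ a)) :=
  H.T₁_T₂ p a c

theorem mul_lTensor_T₁ (a c p : A) : (LinearMap.mul ℂ A p).lTensor A (H.T₁ (a ⊗ₜ c)) =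
    ((LinearMap.mul ℂ A).flip c).lTensor A (H.T₄ (p ⊗ₜ a)) :=
  H.toMultiplier_injective <| by
    rw [← mulL_oneTmul_eq, ← mulR_oneTmul_eq, toMultiplier_mulL_apply, toMultiplier_mulR_apply,
      H.T₁_spec, H.T₄_spec, mul_assoc]

theorem mul_rTensor_T₃ (a c p : A) : (LinearMap.mul ℂ A p).rTensor A (H.T₃ (a ⊗ₜ c)) =
    ((LinearMap.mul ℂ A).flip c).rTensor A (H.T₂ (p ⊗ₜ a)) :=
  H.toMultiplier_injective <| by
    rw [← mulL_tmulOne_eq, ← mulR_tmulOne_eq, toMultiplier_mulL_apply, toMultiplier_mulR_apply,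
      H.T₃_spec, H.T₂_spec, mul_assoc]

theorem mul_lTensor_T₃ (a c p : A) : (LinearMap.mul ℂ A p).lTensor A (H.T₃ (a ⊗ₜ c)) =
    ((LinearMap.mul ℂ A).flip c).rTensor A (H.T₄ (p ⊗ₜ a)) :=
  H.toMultiplier_injective <| by
    rw [← mulL_oneTmul_eq, ← mulR_tmulOne_eq, toMultiplier_mulL_apply, toMultiplier_mulR_apply,
      H.T₃_spec, H.T₄_spec, mul_assoc]

theorem T₁_tmul_mul (a b c : A) :
    H.T₁ (a ⊗ₜ (b * c)) = ((LinearMap.mul ℂ A).flip c).lTensor A (H.T₁ (a ⊗ₜ b)) := by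
  refine eq_of_forall_rTensor_eq (LinearMap.mul ℂ A) H.nondegenerate_right fun p => ?_
  rw [rTensor_lTensor, mul_rTensor_T₁, mul_rTensor_T₁, ← LinearMap.lTensor_comp_apply]
  congr 2
  ext x
  exact (mul_assoc x b c).symm

theorem T₂_mulL (a p q : A) : mulL (oneTmul q) (H.T₂ (p ⊗ₜ a)) = mulR (H.comul a) (p ⊗ₜ q) :=
  H.toMultiplier_injective <| by
    rw [toMultiplier_mulL_apply, toMultiplier_mulR_apply, H.T₂_spec, ← mul_assoc,
      oneTmul_mul_tmulOne]

theorem T₃_mulR (a c d : A) : mulR (oneTmul c) (H.T₃ (a ⊗ₜ d)) = mulL (H.comul a) (d ⊗ₜ c) :=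
  H.toMultiplier_injective <| by
    rw [toMultiplier_mulR_apply, toMultiplier_mulL_apply, H.T₃_spec, mul_assoc,
      tmulOne_mul_oneTmul]

theorem T₄_mulL (a p q : A) : mulL (tmulOne p) (H.T₄ (q ⊗ₜ a)) = mulR (H.comul a) (p ⊗ₜ q) :=
  H.toMultiplier_injective <| by
    rw [toMultiplier_mulL_apply, toMultiplier_mulR_apply, H.T₄_spec, ← mul_assoc,
      tmulOne_mul_oneTmul]

theorem comul_mulL_T₁ (a p q : A) : mulL (H.comul a) (H.T₁ (p ⊗ₜ q)) = H.T₁ ((a * p) ⊗ₜ q) :=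
  H.toMultiplier_injective <| by
    rw [toMultiplier_mulL_apply, H.T₁_spec, H.T₁_spec, ← mul_assoc, map_mul]

theorem comul_mulR_T₂ (a p q : A) : mulR (H.comul a) (H.T₂ (q ⊗ₜ p)) = H.T₂ (q ⊗ₜ (p * a)) :=
  H.toMultiplier_injective <| by
    rw [toMultiplier_mulR_apply, H.T₂_spec, H.T₂_spec, mul_assoc, map_mul]

theorem comul_mulR_T₄ (a p q : A) : mulR (H.comul a) (H.T₄ (q ⊗ₜ p)) = H.T₄ (q ⊗ₜ (p * a)) :=
  H.toMultiplier_injective <| by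
    rw [toMultiplier_mulR_apply, H.T₄_spec, H.T₄_spec, mul_assoc, map_mul]

theorem T₁_coassoc (g : A →ₗ[ℂ] ℂ) (a b c : A) : H.T₁ (sliceLeft g A (H.T₂ (a ⊗ₜ b)) ⊗ₜ c) =
    (sliceLeft g A ∘ₗ TensorProduct.curry H.T₂.toLinearMap a).rTensor A (H.T₁ (b ⊗ₜ c)) := by
  have h := congrArg (fun z => sliceLeft g (A ⊗[ℂ] A) (TensorProduct.assoc ℂ A A A z))
    (H.coassoc a b c)
  simp only [LinearEquiv.apply_symm_apply, sliceLeft_lTensor, sliceLeft_assoc_tmul] at h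
  exact h.symm.trans <| LinearMap.congr_fun
    (f := sliceLeft g (A ⊗[ℂ] A) ∘ₗ (TensorProduct.assoc ℂ A A A).toLinearMap ∘ₗ
      H.T₂.toLinearMap.rTensor A ∘ₗ (TensorProduct.assoc ℂ A A A).symm.toLinearMap ∘ₗ
      TensorProduct.mk ℂ A (A ⊗[ℂ] A) a)
    (TensorProduct.ext' fun _ _ => by simp [sliceLeft_assoc_tmul]) (H.T₁ (b ⊗ₜ c))

theorem T₂_coassoc (g : A →ₗ[ℂ] ℂ) (a b c : A) : H.T₂ (c ⊗ₜ sliceRight A g (H.T₁ (b ⊗ₜ a))) =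
    (sliceRight A g ∘ₗ (TensorProduct.curry H.T₁.toLinearMap).flip a).lTensor A
      (H.T₂ (c ⊗ₜ b)) := by
  have h := congrArg (sliceRight (A ⊗[ℂ] A) g) (H.coassoc c b a)
  rw [sliceRight_rTensor, sliceRight_assoc_symm_tmul] at h
  exact h.trans <| LinearMap.congr_fun
    (f := sliceRight (A ⊗[ℂ] A) g ∘ₗ (TensorProduct.assoc ℂ A A A).symm.toLinearMap ∘ₗ
      H.T₁.toLinearMap.lTensor A ∘ₗ (TensorProduct.assoc ℂ A A A).toLinearMap ∘ₗ
      (TensorProduct.mk ℂ (A ⊗[ℂ] A) A).flip a)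
    (TensorProduct.ext' fun _ _ => by simp [sliceRight_assoc_symm_tmul]) (H.T₂ (c ⊗ₜ b))

theorem sliceLeft_mul_T₃ (g : A →ₗ[ℂ] ℂ) (a d : A) :
    sliceLeft (g ∘ₗ LinearMap.mul ℂ A d) A ∘ₗ (TensorProduct.curry H.T₃.toLinearMap).flip a =
      sliceLeft (g ∘ₗ (LinearMap.mul ℂ A).flip a) A ∘ₗ
        TensorProduct.curry H.T₂.toLinearMap d := by
  ext x
  simp [← sliceLeft_rTensor, H.mul_rTensor_T₃]

theorem T₄_coassoc_mul (g : A →ₗ[ℂ] ℂ) (a b c d : A) :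
    H.T₄ (c ⊗ₜ sliceLeft (g ∘ₗ LinearMap.mul ℂ A d) A (H.T₃ (b ⊗ₜ a))) =
      (sliceLeft (g ∘ₗ LinearMap.mul ℂ A d) A ∘ₗ
        (TensorProduct.curry H.T₃.toLinearMap).flip a).rTensor A (H.T₄ (c ⊗ₜ b)) := by
  have h : sliceLeft (g ∘ₗ LinearMap.mul ℂ A d) A (H.T₃ (b ⊗ₜ a)) =
      sliceLeft (g ∘ₗ (LinearMap.mul ℂ A).flip a) A (H.T₂ (d ⊗ₜ b)) :=
    LinearMap.congr_fun (H.sliceLeft_mul_T₃ g a d) b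
  rw [sliceLeft_mul_T₃, h]
  refine eq_of_forall_lTensor_eq (LinearMap.mul ℂ A).flip H.nondegenerate_left fun e => ?_
  rw [← H.mul_lTensor_T₁, H.T₁_coassoc, ← rTensor_lTensor, ← rTensor_lTensor, H.mul_lTensor_T₁]

theorem lTensor_T₄_T₃ (a b c : A) :
    (TensorProduct.curry H.T₄.toLinearMap c).lTensor A (H.T₃ (b ⊗ₜ a)) =
      TensorProduct.assoc ℂ A A A
        (((TensorProduct.curry H.T₃.toLinearMap).flip a).rTensor A (H.T₄ (c ⊗ₜ b))) := by
  refine eq_of_forall_rTensor_eq (LinearMap.mul ℂ A) H.nondegenerate_right fun d => ?_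
  refine eq_of_sliceLeft_eq fun g => ?_
  rw [sliceLeft_rTensor, sliceLeft_rTensor, sliceLeft_lTensor, sliceLeft_assoc_rTensor]
  exact H.T₄_coassoc_mul g a b c d

theorem T₄_coassoc (g : A →ₗ[ℂ] ℂ) (a b c : A) : H.T₄ (c ⊗ₜ sliceLeft g A (H.T₃ (b ⊗ₜ a))) =
    (sliceLeft g A ∘ₗ (TensorProduct.curry H.T₃.toLinearMap).flip a).rTensor A
      (H.T₄ (c ⊗ₜ b)) := by
  rw [← sliceLeft_assoc_rTensor, ← H.lTensor_T₄_T₃, sliceLeft_lTensor]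
  rfl

theorem T₃_coassoc (g : A →ₗ[ℂ] ℂ) (a b c : A) : H.T₃ (sliceRight A g (H.T₄ (a ⊗ₜ b)) ⊗ₜ c) =
    (sliceRight A g ∘ₗ TensorProduct.curry H.T₄.toLinearMap a).lTensor A (H.T₃ (b ⊗ₜ c)) := by
  rw [← sliceRight_assoc_symm_lTensor, H.lTensor_T₄_T₃, LinearEquiv.symm_apply_apply,
    sliceRight_rTensor]
  rfl

/-- The canonical maps of `A`. -/
def canonicalMaps : CanonicalMaps A where
  mul := LinearMap.mul ℂ A
  mul_assoc := mul_assoc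
  left_nondegenerate := H.nondegenerate_left
  right_nondegenerate := H.nondegenerate_right
  T₁ := H.T₁
  T₂ := H.T₂
  T₃ := H.T₃
  T₄ := H.T₄
  L := mulLHom ∘ₗ (H.comul : A →ₗ[ℂ] MultiplierAlgebra (A ⊗[ℂ] A))
  R :=
    { toFun := fun a => mulR (H.comul a)
      map_add' := fun a b => by rw [map_add]; rfl
      map_smul' := fun r a => by rw [map_smul]; rfl }
  T₁_L := H.T₁_mulR
  T₂_R := H.T₂_mulL
  T₃_L := H.T₃_mulR
  T₄_R := H.T₄_mulL
  T₁_T₂ := H.mul_rTensor_T₁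
  T₁_T₄ := H.mul_lTensor_T₁
  T₃_T₂ := H.mul_rTensor_T₃
  T₃_T₄ := H.mul_lTensor_T₃
  L_T₁ := H.comul_mulL_T₁
  R_T₂ := H.comul_mulR_T₂
  L_T₃ := H.comul_mulL_T₃
  R_T₄ := H.comul_mulR_T₄
  T₁_coassoc := H.T₁_coassoc
  T₂_coassoc := H.T₂_coassoc
  T₃_coassoc := H.T₃_coassoc
  T₄_coassoc := H.T₄_coassoc

theorem mulL_mulR (H : RegularMultiplierHopfAlgebra A) (m n : MultiplierAlgebra (A ⊗[ℂ] A))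
    (x : A ⊗[ℂ] A) : mulL m (mulR n x) = mulR n (mulL m x) := by
  apply H.toMultiplier_injective
  rw [toMultiplier_mulL_apply, toMultiplier_mulR_apply, toMultiplier_mulR_apply,
    toMultiplier_mulL_apply, mul_assoc]

theorem comul_eq_of_T₂_eq {H K : RegularMultiplierHopfAlgebra A} (h : H.T₂ = K.T₂) :
    H.comul = K.comul := by
  ext a : 1
  refine multiplier_ext_mulR H.nondegenerate_right H.nondegenerate_right fun x =>
    eq_of_forall_lTensor_eq (LinearMap.mul ℂ A) H.nondegenerate_right fun q => ?_
  rw [← mulL_oneTmul_eq, H.mulL_mulR, H.mulL_mulR, mulL_oneTmul_eq]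
  induction x with
  | zero => simp
  | add x y hx hy => simp only [map_add, hx, hy]
  | tmul p r => rw [LinearMap.lTensor_tmul, ← H.T₂_mulL, ← K.T₂_mulL, h]

theorem ext_T₂ {H K : RegularMultiplierHopfAlgebra A} (h : H.T₂ = K.T₂) : H = K := by
  have hcomul := comul_eq_of_T₂_eq h
  have h₁ : H.T₁ = K.T₁ := LinearEquiv.toLinearMap_injective (TensorProduct.ext' fun a b =>
    H.toMultiplier_injective ((H.T₁_spec a b).trans (hcomul ▸ (K.T₁_spec a b).symm)))
  have h₃ : H.T₃ = K.T₃ := LinearEquiv.toLinearMap_injective (TensorProduct.ext' fun a b =>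
    H.toMultiplier_injective ((H.T₃_spec a b).trans (hcomul ▸ (K.T₃_spec a b).symm)))
  have h₄ : H.T₄ = K.T₄ := LinearEquiv.toLinearMap_injective (TensorProduct.ext' fun a b =>
    H.toMultiplier_injective ((H.T₄_spec a b).trans (hcomul ▸ (K.T₄_spec a b).symm)))
  cases H
  cases K
  simp only at h h₁ h₃ h₄ hcomul
  subst h h₁ h₃ h₄ hcomul
  rfl

end RegularMultiplierHopfAlgebra

section Dual

/-! ### The dual and its actions -/

variable {A : Type*} [NonUnitalRing A] [Module ℂ A] [SMulCommClass ℂ A A] [IsScalarTower ℂ A A]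
  {H : RegularMultiplierHopfAlgebra A}

theorem RegularMultiplierHopfAlgebra.cancel_right (H : RegularMultiplierHopfAlgebra A) {x y : A}
    (h : ∀ p, x * p = y * p) : x = y :=
  H.canonicalMaps.right_cancel h

theorem RightIntegral.isRightInvariant (ψ : RightIntegral H) :
    H.canonicalMaps.IsRightInvariant ψ.toFun :=
  ⟨ψ.invariant_left, ψ.invariant_right⟩

namespace LeftIntegral

variable (φ : LeftIntegral H)

theorem isLeftInvariant : H.canonicalMaps.IsLeftInvariant φ.toFun :=
  ⟨φ.invariant_right, φ.invariant_left⟩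

theorem nontrivial (φ : LeftIntegral H) : Nontrivial A := by
  obtain ⟨u, hu⟩ := DFunLike.ne_iff.mp φ.ne_zero
  exact ⟨u, 0, fun h => hu (by rw [h, map_zero, map_zero])⟩

theorem exists_isCounit (φ : LeftIntegral H) : ∃ ε, H.canonicalMaps.IsCounit ε :=
  have := φ.nontrivial
  H.canonicalMaps.exists_isCounit

/-- The counit of a regular multiplier Hopf algebra with a left integral. -/
noncomputable def counit : A →ₗ[ℂ] ℂ := φ.exists_isCounit.choose

theorem isCounit : H.canonicalMaps.IsCounit φ.counit := φ.exists_isCounit.choose_spec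

theorem exists_isAntipode :
    ∃ S : A ≃ₗ[ℂ] A, H.canonicalMaps.IsAntipode φ.counit S.toLinearMap := by
  have := φ.nontrivial
  obtain ⟨S, hS⟩ := φ.isLeftInvariant.exists_isAntipode φ.ne_zero φ.isCounit
  exact ⟨.ofBijective S (φ.isLeftInvariant.antipode_bijective φ.ne_zero φ.isCounit hS), hS⟩

/-- The antipode of a regular multiplier Hopf algebra with a left integral. -/
noncomputable def antipode : A ≃ₗ[ℂ] A := φ.exists_isAntipode.choose

theorem isAntipode : H.canonicalMaps.IsAntipode φ.counit φ.antipode.toLinearMap :=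
  φ.exists_isAntipode.choose_spec

theorem antipode_mul (a b : A) : φ.antipode (a * b) = φ.antipode b * φ.antipode a :=
  φ.isAntipode.map_mul φ.isCounit a b

theorem antipode_sliceRight_T₁ (x : A ⊗[ℂ] A) :
    φ.antipode (sliceRight A φ.toFun (H.T₁ x)) = sliceRight A φ.toFun (H.T₄ x) :=
  φ.isLeftInvariant.antipode_sliceRight_T₁ φ.isCounit φ.isAntipode x

theorem antipode_sliceLeft_T₂ (ψ : RightIntegral H) (x : A ⊗[ℂ] A) :
    φ.antipode (sliceLeft ψ.toFun A (H.T₂ x)) = sliceLeft ψ.toFun A (H.T₃ x) :=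
  ψ.isRightInvariant.antipode_sliceLeft_T₂ φ.isCounit φ.isAntipode x

theorem isRightInvariant_comp_antipode :
    H.canonicalMaps.IsRightInvariant (φ.toFun ∘ₗ φ.antipode.toLinearMap) :=
  φ.isLeftInvariant.comp_antipode φ.ne_zero φ.isCounit φ.isAntipode

/-- The right integral `φ ∘ S`. -/
noncomputable def rightIntegral : RightIntegral H where
  toFun := φ.toFun ∘ₗ φ.antipode.toLinearMap
  ne_zero := comp_ne_zero_of_surjective φ.ne_zero φ.antipode.surjective
  invariant_left := φ.isRightInvariant_comp_antipode.T₁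
  invariant_right := φ.isRightInvariant_comp_antipode.T₄

theorem eq_zero_of_apply_mul_right {a : A} (h : ∀ b, φ.toFun (b * a) = 0) : a = 0 :=
  have := φ.nontrivial
  φ.isLeftInvariant.eq_zero_of_apply_mul_right φ.ne_zero h

theorem eq_zero_of_apply_mul_left {a : A} (h : ∀ b, φ.toFun (a * b) = 0) : a = 0 :=
  have := φ.nontrivial
  φ.isLeftInvariant.eq_zero_of_apply_mul_left φ.ne_zero h

variable {φ} in
theorem dual_ext {b b' : φ.dual} (h : ∀ x, b.1 x = b'.1 x) : b = b' :=
  Subtype.ext (LinearMap.ext h)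

theorem eq_of_dual_apply {x y : A} (h : ∀ b : φ.dual, b.1 x = b.1 y) : x = y := by
  refine sub_eq_zero.mp <| φ.eq_zero_of_apply_mul_left fun c => ?_
  simpa [sub_mul, sub_eq_zero] using h (φ.elem c)

/-- The linear isomorphism `c ↦ φ(· c)` from `A` to its dual. -/
noncomputable def elemEquiv : A ≃ₗ[ℂ] φ.dual :=
  LinearEquiv.ofBijective φ.functional.rangeRestrict
    ⟨(injective_iff_map_eq_zero _).mpr fun _ hc =>
      φ.eq_zero_of_apply_mul_right fun b => LinearMap.congr_fun (congrArg Subtype.val hc) b,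
      LinearMap.surjective_rangeRestrict _⟩

@[simp] theorem elemEquiv_apply (c : A) : φ.elemEquiv c = φ.elem c := rfl

@[simp] theorem elemEquiv_symm_elem (c : A) : φ.elemEquiv.symm (φ.elem c) = c :=
  φ.elemEquiv.symm_apply_apply c

theorem elem_surjective : Function.Surjective φ.elem := φ.elemEquiv.surjective

theorem apply_mul_elemEquiv_symm (b : φ.dual) (x : A) :
    φ.toFun (x * φ.elemEquiv.symm b) = b.1 x := by
  rw [← coe_elem, ← elemEquiv_apply, LinearEquiv.apply_symm_apply]

theorem exists_eq_rightIntegral (ψ : RightIntegral H) (b : φ.dual) :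
    ∃ d, ∀ x, b.1 x = ψ.toFun (x * d) := by
  obtain ⟨c, rfl⟩ := φ.elem_surjective b
  exact CanonicalMaps.exists_apply_mul_right_eq_of_isLeftInvariant φ.isLeftInvariant
    ψ.isRightInvariant ψ.ne_zero c

theorem exists_dual_eq_rightIntegral (ψ : RightIntegral H) (c : A) :
    ∃ b : φ.dual, ∀ x, b.1 x = ψ.toFun (x * c) := by
  obtain ⟨d, hd⟩ := CanonicalMaps.exists_apply_mul_right_eq_of_isRightInvariant
    φ.isLeftInvariant ψ.isRightInvariant φ.ne_zero c
  exact ⟨φ.elem d, fun x => (hd x).symm⟩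

theorem exists_dual_eq_left (c : A) : ∃ b : φ.dual, ∀ x, b.1 x = φ.toFun (c * x) := by
  obtain ⟨d, hd⟩ := CanonicalMaps.exists_apply_mul_left_eq φ.isLeftInvariant
    φ.rightIntegral.isRightInvariant φ.rightIntegral.ne_zero φ.isCounit φ.isAntipode
    φ.antipode.surjective c
  obtain ⟨b, hb⟩ := φ.exists_dual_eq_rightIntegral φ.rightIntegral d
  exact ⟨b, fun x => (hb x).trans (hd x).symm⟩

theorem exists_eq_left (b : φ.dual) : ∃ c, ∀ x, b.1 x = φ.toFun (c * x) := by
  obtain ⟨d, hd⟩ := φ.exists_eq_rightIntegral φ.rightIntegral b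
  obtain ⟨c, hc⟩ := CanonicalMaps.exists_apply_mul_right_eq φ.isLeftInvariant
    φ.rightIntegral.isRightInvariant φ.ne_zero φ.isCounit φ.isAntipode φ.antipode.surjective d
  exact ⟨c, fun x => (hd x).trans (hc x)⟩

theorem compr₂_mul_mem_dual (c : A) : (LinearMap.mul ℂ A).compr₂ φ.toFun c ∈ φ.dual := by
  obtain ⟨b, hb⟩ := φ.exists_dual_eq_left c
  rw [show (LinearMap.mul ℂ A).compr₂ φ.toFun c = b.1 from LinearMap.ext fun x => (hb x).symm]
  exact b.2

/-- The linear isomorphism `c ↦ φ(c ·)` from `A` to its dual. -/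
noncomputable def leftEquiv : A ≃ₗ[ℂ] φ.dual :=
  LinearEquiv.ofBijective
    (((LinearMap.mul ℂ A).compr₂ φ.toFun).codRestrict φ.dual φ.compr₂_mul_mem_dual)
    ⟨(injective_iff_map_eq_zero _).mpr fun _ hc =>
      φ.eq_zero_of_apply_mul_left fun b => LinearMap.congr_fun (congrArg Subtype.val hc) b,
      fun b => (φ.exists_eq_left b).imp fun _ hc => dual_ext fun x => (hc x).symm⟩

@[simp] theorem leftEquiv_apply (c x : A) : (φ.leftEquiv c).1 x = φ.toFun (c * x) := rfl

theorem compr₂_mul_flip_mem_dual (ψ : RightIntegral H) (c : A) :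
    (LinearMap.mul ℂ A).flip.compr₂ ψ.toFun c ∈ φ.dual := by
  obtain ⟨b, hb⟩ := φ.exists_dual_eq_rightIntegral ψ c
  rw [show (LinearMap.mul ℂ A).flip.compr₂ ψ.toFun c = b.1 from
    LinearMap.ext fun x => (hb x).symm]
  exact b.2

theorem eq_zero_of_rightIntegral_apply_mul {c : A}
    (h : ∀ a, φ.rightIntegral.toFun (a * c) = 0) : c = 0 := by
  rw [← φ.antipode.map_eq_zero_iff]
  refine φ.eq_zero_of_apply_mul_left fun b => ?_
  obtain ⟨a, rfl⟩ := φ.antipode.surjective b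
  rw [← antipode_mul]
  exact h a

/-- The linear isomorphism `c ↦ ψ(· c)` from `A` to its dual, where `ψ = φ ∘ S`. -/
noncomputable def rightEquiv : A ≃ₗ[ℂ] φ.dual :=
  LinearEquiv.ofBijective
    (((LinearMap.mul ℂ A).flip.compr₂ φ.rightIntegral.toFun).codRestrict φ.dual
      (φ.compr₂_mul_flip_mem_dual φ.rightIntegral))
    ⟨(injective_iff_map_eq_zero _).mpr fun _ hc =>
      φ.eq_zero_of_rightIntegral_apply_mul fun a =>
        LinearMap.congr_fun (congrArg Subtype.val hc) a,
      fun b => (φ.exists_eq_rightIntegral φ.rightIntegral b).imp fun _ hc =>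
        dual_ext fun x => (hc x).symm⟩

/-- The modular automorphism `σ` of `φ`, characterized by `φ(ab) = φ(b σ(a))`. -/
noncomputable def modular : A →ₙₐ[ℂ] A where
  toFun a := φ.elemEquiv.symm (φ.leftEquiv a)
  map_smul' r a := by simp
  map_zero' := by simp
  map_add' a b := by simp
  map_mul' a b := by
    rw [LinearEquiv.symm_apply_eq, elemEquiv_apply]
    refine dual_ext fun x => ?_
    rw [coe_elem, ← mul_assoc, apply_mul_elemEquiv_symm, leftEquiv_apply, leftEquiv_apply,
      ← mul_assoc, apply_mul_elemEquiv_symm, leftEquiv_apply, mul_assoc]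

theorem apply_mul_modular (a b : A) : φ.toFun (b * φ.modular a) = φ.toFun (a * b) :=
  φ.apply_mul_elemEquiv_symm _ _

theorem modular_bijective : Function.Bijective φ.modular :=
  φ.elemEquiv.symm.bijective.comp φ.leftEquiv.bijective

/-- The left action `b ▹ a = (ι ⊗ b)Δ(a)` of the dual on `A`. -/
noncomputable def leftAction : φ.dual →ₗ[ℂ] A →ₗ[ℂ] A :=
  (TensorProduct.curry (sliceRight A φ.toFun ∘ₗ H.T₁.toLinearMap)).flip ∘ₗ
    φ.elemEquiv.symm.toLinearMap

/-- The right action `a ◃ b = (b ⊗ ι)Δ(a)` of the dual on `A`. -/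
noncomputable def rightAction : A →ₗ[ℂ] φ.dual →ₗ[ℂ] A :=
  (TensorProduct.curry (sliceLeft φ.toFun A ∘ₗ H.T₃.toLinearMap)).compl₂
    φ.elemEquiv.symm.toLinearMap

theorem leftAction_elem (c a : A) :
    φ.leftAction (φ.elem c) a = sliceRight A φ.toFun (H.T₁ (a ⊗ₜ c)) := by
  simp [leftAction]

theorem rightAction_elem (c a : A) :
    φ.rightAction a (φ.elem c) = sliceLeft φ.toFun A (H.T₃ (a ⊗ₜ c)) := by
  simp [rightAction]

theorem mul_leftAction (p a : A) (b : φ.dual) :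
    p * φ.leftAction b a = sliceRight A b.1 (H.T₂ (p ⊗ₜ a)) := by
  obtain ⟨c, rfl⟩ := φ.elem_surjective b
  rw [leftAction_elem, mul_slice]
  rfl

theorem rightAction_mul (p a : A) (b : φ.dual) :
    φ.rightAction a b * p = sliceLeft b.1 A (H.T₁ (a ⊗ₜ p)) := by
  obtain ⟨c, rfl⟩ := φ.elem_surjective b
  rw [rightAction_elem]
  change (LinearMap.mul ℂ A).flip p _ = _
  rw [← sliceLeft_lTensor, ← mulR_oneTmul_eq, H.T₃_mulR, ← H.T₁_mulR, mulR_tmulOne_eq,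
    sliceLeft_rTensor]
  rfl

section

variable {φ} {b : φ.dual} {f : A →ₗ[ℂ] ℂ} {e : A}

theorem leftAction_eq_sliceRight_T₁ (h : ∀ x, b.1 x = f (x * e)) (a : A) :
    φ.leftAction b a = sliceRight A f (H.T₁ (a ⊗ₜ e)) := by
  refine H.cancel_left fun p => ?_
  have hb : b.1 = f ∘ₗ (LinearMap.mul ℂ A).flip e := LinearMap.ext h
  rw [mul_leftAction, hb, ← sliceRight_lTensor, ← H.mul_rTensor_T₁, sliceRight_rTensor]
  rfl

theorem leftAction_eq_sliceRight_T₄ (h : ∀ x, b.1 x = f (e * x)) (a : A) :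
    φ.leftAction b a = sliceRight A f (H.T₄ (e ⊗ₜ a)) := by
  refine H.cancel_left fun p => ?_
  have hb : b.1 = f ∘ₗ LinearMap.mul ℂ A e := LinearMap.ext h
  rw [mul_leftAction, hb, ← sliceRight_lTensor, ← mulL_oneTmul_eq, H.T₂_mulL, ← H.T₄_mulL,
    mulL_tmulOne_eq, sliceRight_rTensor]
  rfl

theorem rightAction_eq_sliceLeft_T₃ (h : ∀ x, b.1 x = f (x * e)) (a : A) :
    φ.rightAction a b = sliceLeft f A (H.T₃ (a ⊗ₜ e)) := by
  refine H.cancel_right fun p => ?_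
  have hb : b.1 = f ∘ₗ (LinearMap.mul ℂ A).flip e := LinearMap.ext h
  change _ = (LinearMap.mul ℂ A).flip p _
  rw [rightAction_mul, hb, ← sliceLeft_rTensor, ← mulR_tmulOne_eq, H.T₁_mulR, ← H.T₃_mulR,
    mulR_oneTmul_eq, sliceLeft_lTensor]

end

theorem apply_leftAction (a : A) (b b' : φ.dual) : b'.1 (φ.leftAction b a) = (b' * b).1 a := by
  rw [dual_mul_apply, leftAction_eq_sliceRight_T₁ (f := φ.toFun) (e := φ.repr b)]
  intro x
  rw [← functional_apply, functional_repr]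

theorem apply_rightAction (a : A) (b b' : φ.dual) :
    b'.1 (φ.rightAction a b) = (b * b').1 a := by
  obtain ⟨c, rfl⟩ := φ.elem_surjective b
  obtain ⟨d, rfl⟩ := φ.elem_surjective b'
  rw [elem_mul_elem_apply, ← H.T₃_mulR, apply_sliceRight, mulR_oneTmul_eq, sliceLeft_lTensor,
    rightAction_elem]
  rfl

theorem leftAction_dual_mul (b b' : φ.dual) (a : A) :
    φ.leftAction (b * b') a = φ.leftAction b (φ.leftAction b' a) :=
  φ.eq_of_dual_apply fun x => by simp only [apply_leftAction, mul_assoc]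

theorem rightAction_dual_mul (b b' : φ.dual) (a : A) :
    φ.rightAction a (b * b') = φ.rightAction (φ.rightAction a b) b' :=
  φ.eq_of_dual_apply fun x => by simp only [apply_rightAction, mul_assoc]

theorem span_leftAction :
    Submodule.span ℂ {x : A | ∃ (b : φ.dual) (a : A), φ.leftAction b a = x} = ⊤ := by
  refine eq_top_mono (Submodule.span_mono ?_) (span_apply_tmul_eq_top
    (f := sliceRight A φ.toFun ∘ₗ H.T₁.toLinearMap)
    ((sliceRight_surjective φ.ne_zero).comp H.T₁.surjective))
  rintro _ ⟨a, c, rfl⟩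
  exact ⟨φ.elem c, a, φ.leftAction_elem c a⟩

theorem span_rightAction :
    Submodule.span ℂ {x : A | ∃ (b : φ.dual) (a : A), φ.rightAction a b = x} = ⊤ := by
  refine eq_top_mono (Submodule.span_mono ?_) (span_apply_tmul_eq_top
    (f := sliceLeft φ.toFun A ∘ₗ H.T₃.toLinearMap)
    ((sliceLeft_surjective φ.ne_zero).comp H.T₃.surjective))
  rintro _ ⟨a, c, rfl⟩
  exact ⟨φ.elem c, a, φ.rightAction_elem c a⟩

/-! ### The canonical maps of the dual -/

/-- The pairing of `A ⊗ A` with the tensor square of the dual. -/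
noncomputable def pairing₂ : A ⊗[ℂ] A →ₗ[ℂ] φ.dual ⊗[ℂ] φ.dual →ₗ[ℂ] ℂ :=
  tensorPairing φ.pairing φ.pairing

@[simp] theorem pairing₂_tmul (a a' : A) (b b' : φ.dual) :
    φ.pairing₂ (a ⊗ₜ a') (b ⊗ₜ b') = b.1 a * b'.1 a' :=
  tensorPairing_tmul ..

theorem pairing_left_nondegenerate (a : A) (h : ∀ b, φ.pairing a b = 0) : a = 0 :=
  φ.eq_of_dual_apply fun b => (h b).trans (map_zero _).symm

theorem pairing_right_nondegenerate (b : φ.dual) (h : ∀ a, φ.pairing a b = 0) : b = 0 :=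
  φ.dual_ext h

theorem pairing₂_ext_right {Y Z : φ.dual ⊗[ℂ] φ.dual}
    (h : ∀ a a', φ.pairing₂ (a ⊗ₜ a') Y = φ.pairing₂ (a ⊗ₜ a') Z) : Y = Z :=
  tensorPairing_ext_right φ.pairing_right_nondegenerate φ.pairing_right_nondegenerate h

theorem pairing₂_ext_left {x y : A ⊗[ℂ] A}
    (h : ∀ b b', φ.pairing₂ x (b ⊗ₜ b') = φ.pairing₂ y (b ⊗ₜ b')) : x = y :=
  tensorPairing_ext_left φ.pairing_left_nondegenerate φ.pairing_left_nondegenerate h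

/-- The map `c ↦ φ(S(c) ·)`. -/
noncomputable def leftEquivS : A ≃ₗ[ℂ] φ.dual := φ.antipode.trans φ.leftEquiv

/-- The map `c ↦ ψ(· S(c))`, where `ψ = φ ∘ S`. -/
noncomputable def rightEquivS : A ≃ₗ[ℂ] φ.dual := φ.antipode.trans φ.rightEquiv

@[simp] theorem leftEquivS_apply (c x : A) :
    (φ.leftEquivS c).1 x = φ.toFun (φ.antipode c * x) := rfl

@[simp] theorem rightEquivS_apply (c x : A) :
    (φ.rightEquivS c).1 x = φ.rightIntegral.toFun (x * φ.antipode c) := rfl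

theorem leftAction_leftEquiv (c a : A) :
    φ.leftAction (φ.leftEquiv c) a = sliceRight A φ.toFun (H.T₄ (c ⊗ₜ a)) :=
  φ.leftAction_eq_sliceRight_T₄ (fun _ => rfl) a

theorem leftAction_rightEquivS (c a : A) : φ.leftAction (φ.rightEquivS c) a =
    sliceRight A φ.rightIntegral.toFun (H.T₁ (a ⊗ₜ φ.antipode c)) :=
  φ.leftAction_eq_sliceRight_T₁ (fun _ => rfl) a

theorem rightAction_rightEquiv (c a : A) :
    φ.rightAction a (φ.rightEquiv c) = sliceLeft φ.rightIntegral.toFun A (H.T₃ (a ⊗ₜ c)) :=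
  φ.rightAction_eq_sliceLeft_T₃ (fun _ => rfl) a

/-- The canonical map `b ⊗ b' ↦ Δ(b)(1 ⊗ b')` of the dual. -/
noncomputable def dualT₁ : φ.dual ⊗[ℂ] φ.dual ≃ₗ[ℂ] φ.dual ⊗[ℂ] φ.dual :=
  (TensorProduct.congr φ.rightEquivS φ.leftEquiv).symm.trans
    (H.T₂.trans (TensorProduct.congr φ.rightEquivS φ.leftEquiv))

/-- The canonical map `b ⊗ b' ↦ (b ⊗ 1)Δ(b')` of the dual. -/
noncomputable def dualT₂ : φ.dual ⊗[ℂ] φ.dual ≃ₗ[ℂ] φ.dual ⊗[ℂ] φ.dual :=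
  (TensorProduct.congr φ.rightEquiv φ.leftEquivS).symm.trans
    (H.T₁.trans (TensorProduct.congr φ.rightEquiv φ.leftEquivS))

/-- The canonical map `b ⊗ b' ↦ Δ(b)(b' ⊗ 1)` of the dual. -/
noncomputable def dualT₃ : φ.dual ⊗[ℂ] φ.dual ≃ₗ[ℂ] φ.dual ⊗[ℂ] φ.dual :=
  (TensorProduct.congr φ.leftEquivS φ.leftEquiv).symm.trans
    ((TensorProduct.comm ℂ A A).trans (H.T₃.trans ((TensorProduct.comm ℂ A A).trans
      (TensorProduct.congr φ.leftEquiv φ.leftEquivS))))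

/-- The canonical map `b ⊗ b' ↦ (1 ⊗ b)Δ(b')` of the dual. -/
noncomputable def dualT₄ : φ.dual ⊗[ℂ] φ.dual ≃ₗ[ℂ] φ.dual ⊗[ℂ] φ.dual :=
  (TensorProduct.congr φ.rightEquiv φ.rightEquivS).symm.trans
    ((TensorProduct.comm ℂ A A).trans (H.T₄.trans ((TensorProduct.comm ℂ A A).trans
      (TensorProduct.congr φ.rightEquivS φ.rightEquiv))))

theorem dualT₁_tmul (e c : A) : φ.dualT₁ (φ.rightEquivS e ⊗ₜ φ.leftEquiv c) =
    TensorProduct.map φ.rightEquivS.toLinearMap φ.leftEquiv.toLinearMap (H.T₂ (e ⊗ₜ c)) := by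
  simp [dualT₁, TensorProduct.congr]

theorem dualT₂_tmul (c e : A) : φ.dualT₂ (φ.rightEquiv c ⊗ₜ φ.leftEquivS e) =
    TensorProduct.map φ.rightEquiv.toLinearMap φ.leftEquivS.toLinearMap (H.T₁ (c ⊗ₜ e)) := by
  simp [dualT₂, TensorProduct.congr]

theorem dualT₃_tmul (f c : A) : φ.dualT₃ (φ.leftEquivS f ⊗ₜ φ.leftEquiv c) =
    TensorProduct.map φ.leftEquiv.toLinearMap φ.leftEquivS.toLinearMap
      (TensorProduct.comm ℂ A A (H.T₃ (c ⊗ₜ f))) := by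
  simp [dualT₃, TensorProduct.congr]

theorem dualT₄_tmul (c f : A) : φ.dualT₄ (φ.rightEquiv c ⊗ₜ φ.rightEquivS f) =
    TensorProduct.map φ.rightEquivS.toLinearMap φ.rightEquiv.toLinearMap
      (TensorProduct.comm ℂ A A (H.T₄ (f ⊗ₜ c))) := by
  simp [dualT₄, TensorProduct.congr]

theorem antipode_sliceRight_mul_T₂ (e c x : A) :
    φ.antipode (sliceRight A (φ.toFun ∘ₗ (LinearMap.mul ℂ A).flip x) (H.T₂ (e ⊗ₜ c))) =
      φ.leftAction (φ.leftEquiv c) x * φ.antipode e := by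
  rw [← sliceRight_lTensor, ← H.mul_rTensor_T₁, sliceRight_rTensor, LinearMap.mul_apply',
    antipode_mul, antipode_sliceRight_T₁, leftAction_leftEquiv]

theorem antipode_sliceLeft_mul_T₁ (c e x : A) :
    φ.antipode (sliceLeft (φ.rightIntegral.toFun ∘ₗ LinearMap.mul ℂ A x) A (H.T₁ (c ⊗ₜ e))) =
      φ.antipode e * φ.rightAction x (φ.rightEquiv c) := by
  rw [← sliceLeft_rTensor, H.mul_rTensor_T₁, sliceLeft_lTensor, LinearMap.flip_apply,
    LinearMap.mul_apply', antipode_mul, antipode_sliceLeft_T₂, rightAction_rightEquiv]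

theorem antipode_sliceRight_mul_T₃ (c f x : A) :
    φ.antipode (sliceRight A (φ.toFun ∘ₗ (LinearMap.mul ℂ A).flip x) (H.T₃ (c ⊗ₜ f))) =
      φ.antipode f * φ.leftAction (φ.leftEquiv c) x := by
  rw [← sliceRight_lTensor, ← mulR_oneTmul_eq, H.T₃_mulR, ← H.T₁_mulR, mulR_tmulOne_eq,
    sliceRight_rTensor, LinearMap.flip_apply, LinearMap.mul_apply', antipode_mul,
    antipode_sliceRight_T₁, leftAction_leftEquiv]

theorem antipode_sliceLeft_mul_T₄ (f c x : A) :
    φ.antipode (sliceLeft (φ.rightIntegral.toFun ∘ₗ LinearMap.mul ℂ A x) A (H.T₄ (f ⊗ₜ c))) =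
      φ.rightAction x (φ.rightEquiv c) * φ.antipode f := by
  rw [← sliceLeft_rTensor, ← mulL_tmulOne_eq, H.T₄_mulL, ← H.T₂_mulL, mulL_oneTmul_eq,
    sliceLeft_lTensor, LinearMap.mul_apply', antipode_mul, antipode_sliceLeft_T₂,
    rightAction_rightEquiv]

theorem pairing₂_dualT₁ (a a' : A) (b b' : φ.dual) :
    φ.pairing₂ (a ⊗ₜ a') (φ.dualT₁ (b ⊗ₜ b')) = b.1 (a * φ.leftAction b' a') := by
  obtain ⟨e, rfl⟩ := φ.rightEquivS.surjective b
  obtain ⟨c, rfl⟩ := φ.leftEquiv.surjective b'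
  rw [dualT₁_tmul, rightEquivS_apply, mul_assoc, ← antipode_sliceRight_mul_T₂]
  exact tensorPairing_tmul_map_right ..

theorem pairing₂_dualT₂ (a a' : A) (b b' : φ.dual) :
    φ.pairing₂ (a ⊗ₜ a') (φ.dualT₂ (b ⊗ₜ b')) = b'.1 (φ.rightAction a b * a') := by
  obtain ⟨c, rfl⟩ := φ.rightEquiv.surjective b
  obtain ⟨e, rfl⟩ := φ.leftEquivS.surjective b'
  rw [dualT₂_tmul, leftEquivS_apply, ← mul_assoc, ← antipode_sliceLeft_mul_T₁]
  exact tensorPairing_tmul_map_left ..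

theorem pairing₂_dualT₃ (a a' : A) (b b' : φ.dual) :
    φ.pairing₂ (a ⊗ₜ a') (φ.dualT₃ (b ⊗ₜ b')) = b.1 (φ.leftAction b' a * a') := by
  obtain ⟨f, rfl⟩ := φ.leftEquivS.surjective b
  obtain ⟨c, rfl⟩ := φ.leftEquiv.surjective b'
  rw [dualT₃_tmul, leftEquivS_apply, ← mul_assoc, ← antipode_sliceRight_mul_T₃, ← sliceLeft_comm]
  exact tensorPairing_tmul_map_left ..

theorem pairing₂_dualT₄ (a a' : A) (b b' : φ.dual) :
    φ.pairing₂ (a ⊗ₜ a') (φ.dualT₄ (b ⊗ₜ b')) = b'.1 (a * φ.rightAction a' b) := by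
  obtain ⟨c, rfl⟩ := φ.rightEquiv.surjective b
  obtain ⟨f, rfl⟩ := φ.rightEquivS.surjective b'
  rw [dualT₄_tmul, rightEquivS_apply, mul_assoc, ← antipode_sliceLeft_mul_T₄, ← sliceRight_comm]
  exact tensorPairing_tmul_map_right ..

/-- The left action of the tensor square of the dual on `A ⊗ A`. -/
noncomputable def leftAction₂ : φ.dual ⊗[ℂ] φ.dual →ₗ[ℂ] A ⊗[ℂ] A →ₗ[ℂ] A ⊗[ℂ] A :=
  TensorProduct.map₂ φ.leftAction φ.leftAction

/-- The right action of the tensor square of the dual on `A ⊗ A`. -/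
noncomputable def rightAction₂ : φ.dual ⊗[ℂ] φ.dual →ₗ[ℂ] A ⊗[ℂ] A →ₗ[ℂ] A ⊗[ℂ] A :=
  TensorProduct.map₂ φ.rightAction.flip φ.rightAction.flip

theorem leftAction₂_tmul (b b' : φ.dual) (x : A ⊗[ℂ] A) :
    φ.leftAction₂ (b ⊗ₜ b') x = (φ.leftAction b).rTensor A ((φ.leftAction b').lTensor A x) :=
  LinearMap.congr_fun (g := (φ.leftAction b).rTensor A ∘ₗ (φ.leftAction b').lTensor A)
    (TensorProduct.ext' fun _ _ => by simp [leftAction₂]) x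

theorem rightAction₂_tmul (b b' : φ.dual) (x : A ⊗[ℂ] A) : φ.rightAction₂ (b ⊗ₜ b') x =
    (φ.rightAction.flip b).rTensor A ((φ.rightAction.flip b').lTensor A x) :=
  LinearMap.congr_fun
    (g := (φ.rightAction.flip b).rTensor A ∘ₗ (φ.rightAction.flip b').lTensor A)
    (TensorProduct.ext' fun _ _ => by simp [rightAction₂]) x

/-! ### The coproduct of the dual -/

theorem dual_nondegenerate_left (b : φ.dual) (h : ∀ b', b * b' = 0) : b = 0 := by
  refine Subtype.ext (LinearMap.ext_on φ.span_leftAction ?_)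
  rintro _ ⟨b', a, rfl⟩
  rw [apply_leftAction, h]
  rfl

theorem dual_nondegenerate_right (b : φ.dual) (h : ∀ b', b' * b = 0) : b = 0 := by
  refine Subtype.ext (LinearMap.ext_on φ.span_rightAction ?_)
  rintro _ ⟨b', a, rfl⟩
  rw [apply_rightAction, h]
  rfl

theorem pairing₂_dualT₁_apply (x : A ⊗[ℂ] A) (b b' : φ.dual) :
    φ.pairing₂ x (φ.dualT₁ (b ⊗ₜ b')) =
      b.1 (LinearMap.mul' ℂ A ((φ.leftAction b').lTensor A x)) :=
  LinearMap.congr_fun (f := φ.pairing₂.flip (φ.dualT₁ (b ⊗ₜ b')))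
    (g := b.1 ∘ₗ LinearMap.mul' ℂ A ∘ₗ (φ.leftAction b').lTensor A)
    (TensorProduct.ext' fun a a' => φ.pairing₂_dualT₁ a a' b b') x

theorem pairing₂_dualT₂_apply (x : A ⊗[ℂ] A) (b b' : φ.dual) :
    φ.pairing₂ x (φ.dualT₂ (b ⊗ₜ b')) =
      b'.1 (LinearMap.mul' ℂ A ((φ.rightAction.flip b).rTensor A x)) :=
  LinearMap.congr_fun (f := φ.pairing₂.flip (φ.dualT₂ (b ⊗ₜ b')))
    (g := b'.1 ∘ₗ LinearMap.mul' ℂ A ∘ₗ (φ.rightAction.flip b).rTensor A)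
    (TensorProduct.ext' fun a a' => φ.pairing₂_dualT₂ a a' b b') x

theorem pairing₂_dualT₃_apply (x : A ⊗[ℂ] A) (b b' : φ.dual) :
    φ.pairing₂ x (φ.dualT₃ (b ⊗ₜ b')) =
      b.1 (LinearMap.mul' ℂ A ((φ.leftAction b').rTensor A x)) :=
  LinearMap.congr_fun (f := φ.pairing₂.flip (φ.dualT₃ (b ⊗ₜ b')))
    (g := b.1 ∘ₗ LinearMap.mul' ℂ A ∘ₗ (φ.leftAction b').rTensor A)
    (TensorProduct.ext' fun a a' => φ.pairing₂_dualT₃ a a' b b') x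

theorem pairing₂_dualT₄_apply (x : A ⊗[ℂ] A) (b b' : φ.dual) :
    φ.pairing₂ x (φ.dualT₄ (b ⊗ₜ b')) =
      b'.1 (LinearMap.mul' ℂ A ((φ.rightAction.flip b).lTensor A x)) :=
  LinearMap.congr_fun (f := φ.pairing₂.flip (φ.dualT₄ (b ⊗ₜ b')))
    (g := b'.1 ∘ₗ LinearMap.mul' ℂ A ∘ₗ (φ.rightAction.flip b).lTensor A)
    (TensorProduct.ext' fun a a' => φ.pairing₂_dualT₄ a a' b b') x

theorem pairing₂_mulR_tmulOne (x : A ⊗[ℂ] A) (b : φ.dual) (Y : φ.dual ⊗[ℂ] φ.dual) :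
    φ.pairing₂ x (mulR (tmulOne b) Y) = φ.pairing₂ ((φ.leftAction b).rTensor A x) Y :=
  (tensorPairing_map_map (fun a c => φ.apply_leftAction a b c) (fun _ _ => rfl) x Y).symm

theorem pairing₂_mulR_oneTmul (x : A ⊗[ℂ] A) (b : φ.dual) (Y : φ.dual ⊗[ℂ] φ.dual) :
    φ.pairing₂ x (mulR (oneTmul b) Y) = φ.pairing₂ ((φ.leftAction b).lTensor A x) Y :=
  (tensorPairing_map_map (fun _ _ => rfl) (fun a c => φ.apply_leftAction a b c) x Y).symm

theorem pairing₂_mulL_tmulOne (x : A ⊗[ℂ] A) (b : φ.dual) (Y : φ.dual ⊗[ℂ] φ.dual) :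
    φ.pairing₂ x (mulL (tmulOne b) Y) = φ.pairing₂ ((φ.rightAction.flip b).rTensor A x) Y :=
  (tensorPairing_map_map (fun a c => φ.apply_rightAction a b c) (fun _ _ => rfl) x Y).symm

theorem pairing₂_mulL_oneTmul (x : A ⊗[ℂ] A) (b : φ.dual) (Y : φ.dual ⊗[ℂ] φ.dual) :
    φ.pairing₂ x (mulL (oneTmul b) Y) = φ.pairing₂ ((φ.rightAction.flip b).lTensor A x) Y :=
  (tensorPairing_map_map (fun _ _ => rfl) (fun a c => φ.apply_rightAction a b c) x Y).symm

theorem pairing₂_mul_right (x : A ⊗[ℂ] A) (Y Z : φ.dual ⊗[ℂ] φ.dual) :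
    φ.pairing₂ x (Y * Z) = φ.pairing₂ (φ.leftAction₂ Z x) Y := by
  induction Z with
  | zero => simp
  | add Z Z' hZ hZ' => simp only [mul_add, map_add, LinearMap.add_apply, hZ, hZ']
  | tmul b b' =>
    rw [mul_tmul, rTensor_lTensor, leftAction₂_tmul, ← mulR_tmulOne_eq, ← mulR_oneTmul_eq,
      pairing₂_mulR_oneTmul, pairing₂_mulR_tmulOne]

theorem pairing₂_mul_left (x : A ⊗[ℂ] A) (Y Z : φ.dual ⊗[ℂ] φ.dual) :
    φ.pairing₂ x (Y * Z) = φ.pairing₂ (φ.rightAction₂ Y x) Z := by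
  induction Y with
  | zero => simp
  | add Y Y' hY hY' => simp only [add_mul, map_add, LinearMap.add_apply, hY, hY']
  | tmul b b' =>
    rw [tmul_mul, rTensor_lTensor, rightAction₂_tmul, ← mulL_tmulOne_eq, ← mulL_oneTmul_eq,
      pairing₂_mulL_oneTmul, pairing₂_mulL_tmulOne]

theorem leftAction₂_rightAction₂ (x : A ⊗[ℂ] A) (Y Z : φ.dual ⊗[ℂ] φ.dual) :
    φ.leftAction₂ Y (φ.rightAction₂ Z x) = φ.rightAction₂ Z (φ.leftAction₂ Y x) :=
  φ.pairing₂_ext_left fun b b' => by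
    simp only [← pairing₂_mul_right, ← pairing₂_mul_left, mul_assoc]

theorem leftAction₂_mul (x : A ⊗[ℂ] A) (Y Z : φ.dual ⊗[ℂ] φ.dual) :
    φ.leftAction₂ (Y * Z) x = φ.leftAction₂ Y (φ.leftAction₂ Z x) :=
  φ.pairing₂_ext_left fun b b' => by simp only [← pairing₂_mul_right, mul_assoc]

theorem rightAction₂_mul (x : A ⊗[ℂ] A) (Y Z : φ.dual ⊗[ℂ] φ.dual) :
    φ.rightAction₂ (Y * Z) x = φ.rightAction₂ Z (φ.rightAction₂ Y x) :=
  φ.pairing₂_ext_left fun b b' => by simp only [← pairing₂_mul_left, mul_assoc]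

theorem leftAction₂_mulL_tmulOne (b : φ.dual) (Y : φ.dual ⊗[ℂ] φ.dual) (x : A ⊗[ℂ] A) :
    φ.leftAction₂ (mulL (tmulOne b) Y) x = (φ.leftAction b).rTensor A (φ.leftAction₂ Y x) :=
  φ.pairing₂_ext_left fun c c' => by
    rw [← pairing₂_mul_right, ← mulR_mul_eq, pairing₂_mul_right, pairing₂_mulR_tmulOne]

theorem leftAction₂_mulL_oneTmul (b : φ.dual) (Y : φ.dual ⊗[ℂ] φ.dual) (x : A ⊗[ℂ] A) :
    φ.leftAction₂ (mulL (oneTmul b) Y) x = (φ.leftAction b).lTensor A (φ.leftAction₂ Y x) :=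
  φ.pairing₂_ext_left fun c c' => by
    rw [← pairing₂_mul_right, ← mulR_mul_eq, pairing₂_mul_right, pairing₂_mulR_oneTmul]

theorem leftAction₂_mulR_tmulOne (b : φ.dual) (Y : φ.dual ⊗[ℂ] φ.dual) (x : A ⊗[ℂ] A) :
    φ.leftAction₂ (mulR (tmulOne b) Y) x = φ.leftAction₂ Y ((φ.leftAction b).rTensor A x) :=
  φ.pairing₂_ext_left fun c c' => by
    rw [← pairing₂_mul_right, ← mulR_map_mul, pairing₂_mulR_tmulOne, pairing₂_mul_right]

theorem rightAction₂_mulR_tmulOne (b : φ.dual) (Y : φ.dual ⊗[ℂ] φ.dual) (x : A ⊗[ℂ] A) :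
    φ.rightAction₂ (mulR (tmulOne b) Y) x =
      (φ.rightAction.flip b).rTensor A (φ.rightAction₂ Y x) :=
  φ.pairing₂_ext_left fun c c' => by
    rw [← pairing₂_mul_left, mulR_mul_eq, pairing₂_mul_left, pairing₂_mulL_tmulOne]

theorem rightAction₂_mulR_oneTmul (b : φ.dual) (Y : φ.dual ⊗[ℂ] φ.dual) (x : A ⊗[ℂ] A) :
    φ.rightAction₂ (mulR (oneTmul b) Y) x =
      (φ.rightAction.flip b).lTensor A (φ.rightAction₂ Y x) :=
  φ.pairing₂_ext_left fun c c' => by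
    rw [← pairing₂_mul_left, mulR_mul_eq, pairing₂_mul_left, pairing₂_mulL_oneTmul]

/-- Left multiplication by `Δ(b)`: the map `b' ⊗ b'' ↦ (Δ(b)(1 ⊗ b''))(b' ⊗ 1)`. -/
noncomputable def dualComulL (b : φ.dual) :
    φ.dual ⊗[ℂ] φ.dual →ₗ[ℂ] φ.dual ⊗[ℂ] φ.dual :=
  TensorProduct.lift ((LinearMap.rTensorHom φ.dual ∘ₗ (LinearMap.mul ℂ φ.dual).flip).compl₂
    (TensorProduct.curry φ.dualT₁.toLinearMap b))

/-- Right multiplication by `Δ(b)`: the map `b' ⊗ b'' ↦ (1 ⊗ b'')((b' ⊗ 1)Δ(b))`. -/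
noncomputable def dualComulR (b : φ.dual) :
    φ.dual ⊗[ℂ] φ.dual →ₗ[ℂ] φ.dual ⊗[ℂ] φ.dual :=
  TensorProduct.lift ((LinearMap.lTensorHom φ.dual ∘ₗ LinearMap.mul ℂ φ.dual).compl₂
    ((TensorProduct.curry φ.dualT₂.toLinearMap).flip b)).flip

theorem dualComulL_tmul (b b' b'' : φ.dual) :
    φ.dualComulL b (b' ⊗ₜ b'') = mulR (tmulOne b') (φ.dualT₁ (b ⊗ₜ b'')) :=
  TensorProduct.lift.tmul _ _

theorem dualComulR_tmul (b b' b'' : φ.dual) :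
    φ.dualComulR b (b' ⊗ₜ b'') = mulL (oneTmul b'') (φ.dualT₂ (b' ⊗ₜ b)) :=
  TensorProduct.lift.tmul _ _

theorem pairing₂_dualComulL (b : φ.dual) (Y : φ.dual ⊗[ℂ] φ.dual) (x : A ⊗[ℂ] A) :
    φ.pairing₂ x (φ.dualComulL b Y) = b.1 (LinearMap.mul' ℂ A (φ.leftAction₂ Y x)) := by
  induction Y with
  | zero => simp
  | add Y Y' hY hY' => simp only [map_add, LinearMap.add_apply, hY, hY']
  | tmul c c' =>
    rw [dualComulL_tmul, pairing₂_mulR_tmulOne, pairing₂_dualT₁_apply, leftAction₂_tmul,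
      rTensor_lTensor]

theorem pairing₂_dualComulR (b : φ.dual) (Y : φ.dual ⊗[ℂ] φ.dual) (x : A ⊗[ℂ] A) :
    φ.pairing₂ x (φ.dualComulR b Y) = b.1 (LinearMap.mul' ℂ A (φ.rightAction₂ Y x)) := by
  induction Y with
  | zero => simp
  | add Y Y' hY hY' => simp only [map_add, LinearMap.add_apply, hY, hY']
  | tmul c c' =>
    rw [dualComulR_tmul, pairing₂_mulL_oneTmul, pairing₂_dualT₂_apply, rightAction₂_tmul]

/-- The multiplier `Δ(b)`. -/
noncomputable def dualComulMultiplier (b : φ.dual) : MultiplierAlgebra (φ.dual ⊗[ℂ] φ.dual) :=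
  ⟨(φ.dualComulL b, MulOpposite.op (φ.dualComulR b)),
    fun X Y => φ.pairing₂_ext_right fun a a' => by
      rw [MulOpposite.unop_op, pairing₂_mul_right, pairing₂_dualComulR, pairing₂_mul_left,
        pairing₂_dualComulL, leftAction₂_rightAction₂],
    fun X Y => φ.pairing₂_ext_right fun a a' => by
      rw [pairing₂_dualComulL, pairing₂_mul_right, pairing₂_dualComulL, leftAction₂_mul],
    fun X Y => φ.pairing₂_ext_right fun a a' => by
      rw [MulOpposite.unop_op, pairing₂_dualComulR, pairing₂_mul_left, pairing₂_dualComulR,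
        rightAction₂_mul]⟩

theorem pairing₂_mulL_dualComulMultiplier (b : φ.dual) (Y : φ.dual ⊗[ℂ] φ.dual) (x : A ⊗[ℂ] A) :
    φ.pairing₂ x (mulL (φ.dualComulMultiplier b) Y) =
      b.1 (LinearMap.mul' ℂ A (φ.leftAction₂ Y x)) :=
  φ.pairing₂_dualComulL b Y x

theorem dual_multiplier_ext_mulL {m n : MultiplierAlgebra (φ.dual ⊗[ℂ] φ.dual)}
    (h : ∀ Y a a', φ.pairing₂ (a ⊗ₜ a') (mulL m Y) = φ.pairing₂ (a ⊗ₜ a') (mulL n Y)) : m = n :=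
  multiplier_ext_mulL φ.dual_nondegenerate_left φ.dual_nondegenerate_left fun Y =>
    φ.pairing₂_ext_right (h Y)

theorem dual_multiplier_ext_mulR {m n : MultiplierAlgebra (φ.dual ⊗[ℂ] φ.dual)}
    (h : ∀ Y a a', φ.pairing₂ (a ⊗ₜ a') (mulR m Y) = φ.pairing₂ (a ⊗ₜ a') (mulR n Y)) : m = n :=
  multiplier_ext_mulR φ.dual_nondegenerate_right φ.dual_nondegenerate_right fun Y =>
    φ.pairing₂_ext_right (h Y)

theorem pairing₂_T₁ (a a' d : A) (b : φ.dual) :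
    φ.pairing₂ (H.T₁ (a ⊗ₜ a')) (b ⊗ₜ φ.elem d) = (b * φ.elem (a' * d)).1 a := by
  rw [← apply_leftAction, leftAction_elem, H.T₁_tmul_mul, sliceRight_lTensor, apply_sliceRight]
  exact tensorPairing_tmul_right φ.pairing φ.pairing _ b (φ.elem d)

theorem pairing₂_T₁_leftAction (b b' c : φ.dual) (a a' : A) :
    φ.pairing₂ (H.T₁ (φ.leftAction c a ⊗ₜ a')) (b ⊗ₜ b') =
      b'.1 (φ.leftAction c (φ.rightAction a b) * a') := by
  obtain ⟨d, rfl⟩ := φ.elemEquiv.surjective b'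
  rw [elemEquiv_apply, pairing₂_T₁, apply_leftAction, mul_assoc, ← apply_rightAction,
    ← apply_leftAction, coe_elem, coe_elem, mul_assoc]

theorem T₁_leftAction (e c a : A) :
    H.T₁ (φ.leftAction (φ.leftEquiv c) a ⊗ₜ φ.antipode e) =
      TensorProduct.map (φ.leftAction.flip a ∘ₗ φ.leftEquiv.toLinearMap) φ.antipode.toLinearMap
        (TensorProduct.comm ℂ A A (H.T₂ (e ⊗ₜ c))) := by
  refine φ.pairing₂_ext_left fun b b' => ?_
  have hb : φ.pairing.flip b ∘ₗ φ.leftAction.flip a ∘ₗ φ.leftEquiv.toLinearMap =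
      φ.toFun ∘ₗ (LinearMap.mul ℂ A).flip (φ.rightAction a b) := LinearMap.ext fun s =>
    (φ.apply_leftAction a (φ.leftEquiv s) b).trans (φ.apply_rightAction a b _).symm
  rw [pairing₂_T₁_leftAction, ← antipode_sliceRight_mul_T₂, ← hb, ← sliceLeft_comm]
  exact (tensorPairing_map_tmul φ.pairing φ.pairing ..).symm

theorem leftAction_rightEquivS_mul (r u p : A) : φ.leftAction (φ.rightEquivS r) u * p =
    sliceRight A φ.rightIntegral.toFun (mulL (H.comul u) (p ⊗ₜ φ.antipode r)) := by
  rw [leftAction_rightEquivS, ← H.T₁_mulR, mulR_tmulOne_eq, sliceRight_rTensor]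
  rfl

theorem mul'_leftAction₂_dualT₁ (b b' : φ.dual) (u a : A) :
    LinearMap.mul' ℂ A (φ.leftAction₂ (φ.dualT₁ (b ⊗ₜ b')) (u ⊗ₜ a)) =
      φ.leftAction b (u * φ.leftAction b' a) := by
  obtain ⟨e, rfl⟩ := φ.rightEquivS.surjective b
  obtain ⟨c, rfl⟩ := φ.leftEquiv.surjective b'
  rw [leftAction_rightEquivS, ← H.comul_mulL_T₁, T₁_leftAction, dualT₁_tmul]
  generalize H.T₂ (e ⊗ₜ c) = w
  induction w with
  | zero => simp
  | add w w' hw hw' => simp only [map_add, LinearMap.add_apply, hw, hw']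
  | tmul r s =>
    rw [TensorProduct.map_tmul, leftAction₂_tmul]
    exact φ.leftAction_rightEquivS_mul r u _

theorem mul'_leftAction₂_dualComulL (b : φ.dual) (Y : φ.dual ⊗[ℂ] φ.dual) (x : A ⊗[ℂ] A) :
    LinearMap.mul' ℂ A (φ.leftAction₂ (φ.dualComulL b Y) x) =
      φ.leftAction b (LinearMap.mul' ℂ A (φ.leftAction₂ Y x)) := by
  induction x with
  | zero => simp
  | add x y hx hy => simp only [map_add, hx, hy]
  | tmul a a' =>
    induction Y with
    | zero => simp
    | add Y Y' hY hY' => simp only [map_add, LinearMap.add_apply, hY, hY']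
    | tmul c c' =>
      rw [dualComulL_tmul, leftAction₂_mulR_tmulOne, LinearMap.rTensor_tmul,
        mul'_leftAction₂_dualT₁]
      simp [leftAction₂_tmul]

/-- The coproduct of the dual. -/
noncomputable def dualComul : φ.dual →ₙₐ[ℂ] MultiplierAlgebra (φ.dual ⊗[ℂ] φ.dual) where
  toFun := φ.dualComulMultiplier
  map_smul' r b := φ.dual_multiplier_ext_mulL fun Y a a' => by
    change _ = φ.pairing₂ _ (r • mulL (φ.dualComulMultiplier b) Y)
    simp [pairing₂_mulL_dualComulMultiplier]
  map_zero' := φ.dual_multiplier_ext_mulL fun Y a a' => by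
    change _ = φ.pairing₂ _ 0
    simp [pairing₂_mulL_dualComulMultiplier]
  map_add' b b' := φ.dual_multiplier_ext_mulL fun Y a a' => by
    change _ = φ.pairing₂ _
      (mulL (φ.dualComulMultiplier b) Y + mulL (φ.dualComulMultiplier b') Y)
    simp [pairing₂_mulL_dualComulMultiplier]
  map_mul' b b' := φ.dual_multiplier_ext_mulL fun Y a a' => by
    rw [mulL_mul_apply, pairing₂_mulL_dualComulMultiplier, pairing₂_mulL_dualComulMultiplier,
      ← apply_leftAction, ← mul'_leftAction₂_dualComulL]
    rfl

theorem pairing₂_mulL_dualComul (b : φ.dual) (Y : φ.dual ⊗[ℂ] φ.dual) (x : A ⊗[ℂ] A) :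
    φ.pairing₂ x (mulL (φ.dualComul b) Y) = b.1 (LinearMap.mul' ℂ A (φ.leftAction₂ Y x)) :=
  φ.pairing₂_dualComulL b Y x

theorem pairing₂_mulR_dualComul (b : φ.dual) (Y : φ.dual ⊗[ℂ] φ.dual) (x : A ⊗[ℂ] A) :
    φ.pairing₂ x (mulR (φ.dualComul b) Y) = b.1 (LinearMap.mul' ℂ A (φ.rightAction₂ Y x)) :=
  φ.pairing₂_dualComulR b Y x

theorem toMultiplier_dualT₁ (b b' : φ.dual) :
    toMultiplier (φ.dual ⊗[ℂ] φ.dual) (φ.dualT₁ (b ⊗ₜ b')) = φ.dualComul b * oneTmul b' :=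
  φ.dual_multiplier_ext_mulL fun Y a a' => by
    rw [toMultiplier_mulL, mulL_mul_apply, pairing₂_mul_right, pairing₂_dualT₁_apply,
      pairing₂_mulL_dualComul, leftAction₂_mulL_oneTmul]

theorem toMultiplier_dualT₂ (b b' : φ.dual) :
    toMultiplier (φ.dual ⊗[ℂ] φ.dual) (φ.dualT₂ (b ⊗ₜ b')) = tmulOne b * φ.dualComul b' :=
  φ.dual_multiplier_ext_mulR fun Y a a' => by
    rw [toMultiplier_mulR, mulR_mul_apply, pairing₂_mul_left, pairing₂_dualT₂_apply,
      pairing₂_mulR_dualComul, rightAction₂_mulR_tmulOne]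

theorem toMultiplier_dualT₃ (b b' : φ.dual) :
    toMultiplier (φ.dual ⊗[ℂ] φ.dual) (φ.dualT₃ (b ⊗ₜ b')) = φ.dualComul b * tmulOne b' :=
  φ.dual_multiplier_ext_mulL fun Y a a' => by
    rw [toMultiplier_mulL, mulL_mul_apply, pairing₂_mul_right, pairing₂_dualT₃_apply,
      pairing₂_mulL_dualComul, leftAction₂_mulL_tmulOne]

theorem toMultiplier_dualT₄ (b b' : φ.dual) :
    toMultiplier (φ.dual ⊗[ℂ] φ.dual) (φ.dualT₄ (b ⊗ₜ b')) = oneTmul b * φ.dualComul b' :=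
  φ.dual_multiplier_ext_mulR fun Y a a' => by
    rw [toMultiplier_mulR, mulR_mul_apply, pairing₂_mul_left, pairing₂_dualT₄_apply,
      pairing₂_mulR_dualComul, rightAction₂_mulR_oneTmul]

theorem tensorPairing_rTensor_dualT₂ (a a' a'' : A) (b : φ.dual) (Y : φ.dual ⊗[ℂ] φ.dual) :
    tensorPairing φ.pairing₂ φ.pairing ((a ⊗ₜ a') ⊗ₜ a'')
        (φ.dualT₂.toLinearMap.rTensor φ.dual
          ((TensorProduct.assoc ℂ φ.dual φ.dual φ.dual).symm (b ⊗ₜ Y))) =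
      φ.pairing₂ ((φ.rightAction a b * a') ⊗ₜ a'') Y := by
  induction Y with
  | zero => simp
  | add Y Y' hY hY' => simp only [map_add, TensorProduct.tmul_add, hY, hY']
  | tmul c c' => simp [pairing₂_dualT₂]

theorem tensorPairing_lTensor_dualT₁ (a a' a'' : A) (b : φ.dual) (Y : φ.dual ⊗[ℂ] φ.dual) :
    tensorPairing φ.pairing₂ φ.pairing ((a ⊗ₜ a') ⊗ₜ a'')
        ((TensorProduct.assoc ℂ φ.dual φ.dual φ.dual).symm (φ.dualT₁.toLinearMap.lTensor φ.dual
          (TensorProduct.assoc ℂ φ.dual φ.dual φ.dual (Y ⊗ₜ b)))) =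
      φ.pairing₂ (a ⊗ₜ (a' * φ.leftAction b a'')) Y := by
  induction Y with
  | zero => simp
  | add Y Y' hY hY' => simp only [map_add, TensorProduct.add_tmul, hY, hY']
  | tmul c c' =>
    rw [TensorProduct.assoc_tmul, LinearMap.lTensor_tmul, pairing₂_tmul, ← pairing₂_dualT₁]
    exact tensorPairing_assoc_symm_tmul ..

theorem tensorPairing₂_ext_right {Y Z : (φ.dual ⊗[ℂ] φ.dual) ⊗[ℂ] φ.dual}
    (h : ∀ a a' a'', tensorPairing φ.pairing₂ φ.pairing ((a ⊗ₜ a') ⊗ₜ a'') Y =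
      tensorPairing φ.pairing₂ φ.pairing ((a ⊗ₜ a') ⊗ₜ a'') Z) : Y = Z := by
  refine tensorPairing_ext_right (P := φ.pairing₂) (Q := φ.pairing)
    (fun W hW => φ.pairing₂_ext_right fun a a' => by rw [hW, map_zero])
    φ.pairing_right_nondegenerate fun x a'' => ?_
  induction x with
  | zero => simp
  | add x y hx hy => simp only [TensorProduct.add_tmul, map_add, LinearMap.add_apply, hx, hy]
  | tmul a a' => exact h a a' a''

theorem dual_coassoc (b₁ b₂ b₃ : φ.dual) :
    φ.dualT₂.toLinearMap.rTensor φ.dual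
      ((TensorProduct.assoc ℂ φ.dual φ.dual φ.dual).symm (b₁ ⊗ₜ φ.dualT₁ (b₂ ⊗ₜ b₃))) =
    (TensorProduct.assoc ℂ φ.dual φ.dual φ.dual).symm (φ.dualT₁.toLinearMap.lTensor φ.dual
      (TensorProduct.assoc ℂ φ.dual φ.dual φ.dual (φ.dualT₂ (b₁ ⊗ₜ b₂) ⊗ₜ b₃))) :=
  φ.tensorPairing₂_ext_right fun a a' a'' => by
    rw [tensorPairing_rTensor_dualT₂, tensorPairing_lTensor_dualT₁, pairing₂_dualT₁,
      pairing₂_dualT₂, mul_assoc]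

/-- The dual of a regular multiplier Hopf algebra with a left integral, again a regular multiplier
Hopf algebra; its canonical maps are those of `A`, transported along `c ↦ φ(c ·)` and
`c ↦ φ(S(· c))`. -/
noncomputable def dualHopf : RegularMultiplierHopfAlgebra φ.dual where
  nondegenerate_left := φ.dual_nondegenerate_left
  nondegenerate_right := φ.dual_nondegenerate_right
  comul := φ.dualComul
  T₁ := φ.dualT₁
  T₂ := φ.dualT₂
  T₃ := φ.dualT₃
  T₄ := φ.dualT₄
  T₁_spec := φ.toMultiplier_dualT₁
  T₂_spec := φ.toMultiplier_dualT₂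
  T₃_spec := φ.toMultiplier_dualT₃
  T₄_spec := φ.toMultiplier_dualT₄
  coassoc := φ.dual_coassoc

/-! ### The pairing with the dual -/

/-- The counit of `A`, as a homomorphism. -/
noncomputable def counitHom : A →ₙₐ[ℂ] ℂ where
  toFun := φ.counit
  map_smul' r a := by simp
  map_zero' := map_zero _
  map_add' := map_add _
  map_mul' := φ.isCounit.map_mul

theorem isCounit_counitHom : H.IsCounit φ.counitHom where
  left a b := φ.isCounit.T₁ (a ⊗ₜ b)
  right a b := φ.isCounit.T₂ (a ⊗ₜ b)

theorem isAntipode_antipode : H.IsAntipode φ.counitHom φ.antipode.toLinearMap where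
  left a b := (φ.isAntipode.T₁ (a ⊗ₜ b)).trans (sliceLeft_tmul _ _ _)
  right a b := (φ.isAntipode.T₂ (a ⊗ₜ b)).trans (sliceRight_tmul _ _ _)

/-- The left action `a ▹ φ(· c) = φ(· ac)` of `A` on the dual. -/
noncomputable def leftActionDual : A →ₗ[ℂ] φ.dual →ₗ[ℂ] φ.dual :=
  ((LinearMap.mul ℂ A).compl₂ φ.elemEquiv.symm.toLinearMap).compr₂ φ.elemEquiv.toLinearMap

/-- The right action `φ(· c) ◃ a = φ(· cσ(a))` of `A` on the dual. -/
noncomputable def rightActionDual : φ.dual →ₗ[ℂ] A →ₗ[ℂ] φ.dual :=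
  (((LinearMap.mul ℂ A) ∘ₗ φ.elemEquiv.symm.toLinearMap).compl₂
    (φ.modular : A →ₗ[ℂ] A)).compr₂ φ.elemEquiv.toLinearMap

theorem leftActionDual_elem (a c : A) : φ.leftActionDual a (φ.elem c) = φ.elem (a * c) := by
  simp [leftActionDual]

theorem rightActionDual_elem (a c : A) :
    φ.rightActionDual (φ.elem c) a = φ.elem (c * φ.modular a) := by
  simp [rightActionDual]

theorem leftActionDual_apply (a x : A) (b : φ.dual) :
    (φ.leftActionDual a b).1 x = b.1 (x * a) := by
  obtain ⟨c, rfl⟩ := φ.elem_surjective b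
  rw [leftActionDual_elem, coe_elem, coe_elem, mul_assoc]

theorem rightActionDual_apply (a x : A) (b : φ.dual) :
    (φ.rightActionDual b a).1 x = b.1 (a * x) := by
  obtain ⟨c, rfl⟩ := φ.elem_surjective b
  rw [rightActionDual_elem, coe_elem, coe_elem, ← mul_assoc, apply_mul_modular, mul_assoc]

theorem mul'_surjective (φ : LeftIntegral H) : Function.Surjective (LinearMap.mul' ℂ A) :=
  have := φ.nontrivial
  H.canonicalMaps.mulMap_surjective

theorem span_leftActionDual :
    Submodule.span ℂ {y : φ.dual | ∃ (a : A) (b : φ.dual), φ.leftActionDual a b = y} = ⊤ := by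
  refine eq_top_mono (Submodule.span_mono ?_) (span_apply_tmul_eq_top
    (f := φ.elemEquiv.toLinearMap ∘ₗ LinearMap.mul' ℂ A)
    (φ.elemEquiv.surjective.comp φ.mul'_surjective))
  rintro _ ⟨a, c, rfl⟩
  exact ⟨a, φ.elem c, φ.leftActionDual_elem a c⟩

theorem span_rightActionDual :
    Submodule.span ℂ {y : φ.dual | ∃ (a : A) (b : φ.dual), φ.rightActionDual b a = y} = ⊤ := by
  refine eq_top_mono (Submodule.span_mono ?_) (span_apply_tmul_eq_top
    (f := φ.elemEquiv.toLinearMap ∘ₗ LinearMap.mul' ℂ A)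
    (φ.elemEquiv.surjective.comp φ.mul'_surjective))
  rintro _ ⟨c, a, rfl⟩
  obtain ⟨a, rfl⟩ := φ.modular_bijective.surjective a
  exact ⟨a, φ.elem c, φ.rightActionDual_elem a c⟩

/-- The twist `a ⊗ b ↦ ∑ ⟨a₍₂₎, b₍₁₎⟩ a₍₁₎ ⊗ b₍₂₎`; it maps `a ⊗ φ(e ·)` to
`∑ a₍₁₎ ⊗ φ(e a₍₂₎ ·)`. -/
noncomputable def twist : A ⊗[ℂ] φ.dual ≃ₗ[ℂ] A ⊗[ℂ] φ.dual :=
  (TensorProduct.congr (LinearEquiv.refl ℂ A) φ.leftEquiv).symm.trans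
    ((TensorProduct.comm ℂ A A).trans (H.T₄.trans
      (TensorProduct.congr (LinearEquiv.refl ℂ A) φ.leftEquiv)))

theorem twist_tmul (a e : A) : φ.twist (a ⊗ₜ φ.leftEquiv e) =
    TensorProduct.map LinearMap.id φ.leftEquiv.toLinearMap (H.T₄ (e ⊗ₜ a)) := by
  simp [twist, TensorProduct.congr]

theorem mul_rightAction (e a : A) (b : φ.dual) :
    e * φ.rightAction a b = sliceLeft b.1 A (H.T₄ (e ⊗ₜ a)) := by
  obtain ⟨c, rfl⟩ := φ.elem_surjective b
  rw [rightAction_elem, ← LinearMap.mul_apply' (R := ℂ), ← sliceLeft_lTensor,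
    H.mul_lTensor_T₃, sliceLeft_rTensor]
  rfl

theorem pairing_twist (a a' : A) (b b' : φ.dual) :
    tensorPairing φ.pairing φ.pairing.flip (φ.twist (a ⊗ₜ b)) (b' ⊗ₜ a') =
      b.1 (φ.rightAction a b' * a') := by
  obtain ⟨e, rfl⟩ := φ.leftEquiv.surjective b
  rw [leftEquiv_apply, ← mul_assoc, mul_rightAction, twist_tmul]
  exact tensorPairing_map_tmul φ.pairing φ.pairing.flip ..

/-- The pairing of `A` with its dual. -/
noncomputable def dualPairing : Pairing H φ.dualHopf where
  form := φ.pairing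
  nondegenerate_left := φ.pairing_left_nondegenerate
  nondegenerate_right := φ.pairing_right_nondegenerate
  leftAB := φ.leftActionDual
  rightAB := φ.rightActionDual
  leftBA := φ.leftAction
  rightBA := φ.rightAction
  leftAB_mul a a' b := φ.dual_ext fun x => by simp only [leftActionDual_apply, mul_assoc]
  rightAB_mul a a' b := φ.dual_ext fun x => by simp only [rightActionDual_apply, mul_assoc]
  leftBA_mul := φ.leftAction_dual_mul
  rightBA_mul := φ.rightAction_dual_mul
  form_leftAB a a' b := φ.leftActionDual_apply a a' b
  form_rightAB a a' b := φ.rightActionDual_apply a a' b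
  form_leftBA := φ.apply_leftAction
  form_rightBA := φ.apply_rightAction
  leftAB_unital := φ.span_leftActionDual
  rightAB_unital := φ.span_rightActionDual
  leftBA_unital := φ.span_leftAction
  rightBA_unital := φ.span_rightAction
  form_mul_right a a' b b' := by
    obtain ⟨d, rfl⟩ := φ.elem_surjective b'
    rw [leftActionDual_elem]
    exact φ.pairing₂_T₁ a a' d b
  form_mul_left a a' b b' := φ.pairing₂_dualT₂ a a' b b'
  R := φ.twist
  form_R a a' b b' := (φ.pairing_twist a a' b b').trans (φ.pairing₂_dualT₂ a a' b' b).symm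

theorem eq_dualHopf {K : RegularMultiplierHopfAlgebra φ.dual} (P : Pairing H K)
    (h : P.form = φ.pairing) : K = φ.dualHopf := by
  refine RegularMultiplierHopfAlgebra.ext_T₂ (LinearEquiv.toLinearMap_injective
    (TensorProduct.ext' fun b b' => φ.pairing₂_ext_right fun a a' => ?_))
  have hP : P.rightBA a b = φ.rightAction a b := φ.eq_of_dual_apply fun c =>
    (h ▸ P.form_rightBA a b c).trans (φ.apply_rightAction a b c).symm
  have hT₂ := P.form_mul_left a a' b b'
  rw [hP, h] at hT₂
  exact hT₂.trans (φ.pairing₂_dualT₂ a a' b b').symm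

end LeftIntegral

end Dual

end MultiplierHopf

/-- For a regular multiplier Hopf algebra `A` with a left integral `φ`, the canonical form
`⟨a, φ(· c)⟩ = φ(ac)` on `A × Â` is a pairing of regular multiplier Hopf algebras, with explicit
formulas for the four actions. -/
theorem mainTheorem11 {A : Type*} [NonUnitalRing A] [Module ℂ A] [SMulCommClass ℂ A A]
    [IsScalarTower ℂ A A] (H : MultiplierHopf.RegularMultiplierHopfAlgebra A)
    (φ : MultiplierHopf.LeftIntegral H) :
    -- every element of the dual is `φ(· c)` for a unique `c`, so the form is well defined
    (∀ b : φ.dual, ∃! c : A, b = φ.elem c) ∧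
    -- counit, antipode, modular automorphism of `φ`, and the right integral `φ ∘ S`
    ∃ (ε : A →ₙₐ[ℂ] ℂ) (S : A ≃ₗ[ℂ] A) (σ : A →ₙₐ[ℂ] A),
      H.IsCounit ε ∧ H.IsAntipode ε S.toLinearMap ∧
      (Function.Bijective σ ∧ ∀ a b : A, φ.toFun (a * b) = φ.toFun (b * σ a)) ∧
      (∃ ψ : MultiplierHopf.RightIntegral H, ∀ a : A, ψ.toFun a = φ.toFun (S a)) ∧
      -- the dual is a regular multiplier Hopf algebra and the form is a pairing
      ∃! K : MultiplierHopf.RegularMultiplierHopfAlgebra φ.dual,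
        ∃ P : MultiplierHopf.Pairing H K,
          P.form = φ.pairing ∧
          -- the actions of `A` on the dual
          (∀ a c : A, P.leftAB a (φ.elem c) = φ.elem (a * c)) ∧
          (∀ a c : A, P.rightAB (φ.elem c) a = φ.elem (c * σ a)) ∧
          -- the left action of the dual on `A`: its elements are the functionals `φ(c ·)`
          (∀ c : A, ∃ b : φ.dual, ∀ x : A, b.1 x = φ.toFun (c * x)) ∧
          (∀ b : φ.dual, ∃ c : A, ∀ x : A, b.1 x = φ.toFun (c * x)) ∧
          (∀ (b : φ.dual) (c : A), (∀ x : A, b.1 x = φ.toFun (c * x)) → ∀ a : A,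
            P.leftBA b a = S (MultiplierHopf.sliceRight A φ.toFun (H.T₁ (c ⊗ₜ a)))) ∧
          -- the right action of the dual on `A`: its elements are the functionals `ψ(· c)`
          ∀ ψ : MultiplierHopf.RightIntegral H,
            (∀ c : A, ∃ b : φ.dual, ∀ x : A, b.1 x = ψ.toFun (x * c)) ∧
            (∀ b : φ.dual, ∃ c : A, ∀ x : A, b.1 x = ψ.toFun (x * c)) ∧
            (∀ (b : φ.dual) (c : A), (∀ x : A, b.1 x = ψ.toFun (x * c)) → ∀ a : A,
              P.rightBA a b = S (MultiplierHopf.sliceLeft ψ.toFun A (H.T₂ (a ⊗ₜ c)))) := by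
  refine ⟨fun b => ⟨φ.elemEquiv.symm b, (φ.elemEquiv.apply_symm_apply b).symm, fun c hc => ?_⟩,
    φ.counitHom, φ.antipode, φ.modular, φ.isCounit_counitHom, φ.isAntipode_antipode,
    ⟨φ.modular_bijective, fun a b => (φ.apply_mul_modular a b).symm⟩,
    ⟨φ.rightIntegral, fun a => rfl⟩, φ.dualHopf, ⟨φ.dualPairing, rfl, φ.leftActionDual_elem,
      φ.rightActionDual_elem, φ.exists_dual_eq_left, φ.exists_eq_left, fun b c hb a => ?_,
      fun ψ => ⟨φ.exists_dual_eq_rightIntegral ψ, φ.exists_eq_rightIntegral ψ,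
        fun b c hb a => ?_⟩⟩, ?_⟩
  · rw [hc, φ.elemEquiv_symm_elem]
  · rw [φ.antipode_sliceRight_T₁]
    exact MultiplierHopf.LeftIntegral.leftAction_eq_sliceRight_T₄ hb a
  · rw [φ.antipode_sliceLeft_T₂]
    exact MultiplierHopf.LeftIntegral.rightAction_eq_sliceLeft_T₃ hb a
  · rintro K ⟨P, hP, -⟩
    exact φ.eq_dualHopf P hP
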